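/- Fix an integer $m\ge 1$. For $n\ge 1$ let $G_{m,n}=\mathbb Z_m\wr S_n$ be the generalized symmetric group, i.e. the set of tuples $(\xi^{k_1},\dots,\xi^{k_n},\sigma)$ with $\xi$ a primitive $m$-th root of unity, $k_i\in\mathbb Z_m$, $\sigma\in S_n$, and product $(\xi^{k_i},\sigma)(\xi^{k_i'},\sigma')=(\xi^{k_i}\xi^{k'_{\sigma(i)}},\sigma\sigma')$, where $\sigma\sigma'$ means $\sigma$ followed by $\sigma'$. For $1\le i\le j\le n$ and $k\in\mathbb Z_m$ let $g_{i,j,k}\in G_{m,n}$ be the element whose permutation is $(i\,j)$ (the identity if $i=j$), with entry $\xi^k$ in the places $i$ and $j$ (in the single place $i$ if $i=j$) and entry $1$ in all other places. The unbiased one-sided transposition shuffle $P_n=\mathrm{OST}_{m,n}$ is the random walk on $G_{m,n}$ generated by the law of $g_{i,j,k}$, where the triple $(i,j,k)$ has probability $\frac1{n\,j\,m}$ (probabilities of triples that give the same element are added). Let $P_n^t$ be its $t$-fold convolution power, $U_n$ the uniform distribution on $G_{m,n}$, and $$d_{TV,n}(t)=\tfrac12\sum_{g\in G_{m,n}}|P_n^t(g)-U_n(g)|,\qquad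 d_{Sep,n}(t)=1-\min_{g,h\in G_{m,n}}\frac{P_n^t(hg^{-1})}{U_n(h)}.$$ For $0<\varepsilon<1$ and $d_n\in\{d_{TV,n},d_{Sep,n}\}$ let $t_{mix}^{(n)}(\varepsilon)=\min\{t\in\mathbb{Z}_{\ge0}:d_n(t)<\varepsilon\}$. Theorem. The shuffle exhibits a cutoff at time $n\log n$, both in total variation distance and in separation distance. That is, put $w_n=n\log\log n$; then for $d_n=d_{TV,n}$ as well as for $d_n=d_{Sep,n}$, and for every $0<\varepsilon<1$, $$\lim_{n\to\infty}\frac{t_{mix}^{(n)}(\varepsilon)}{n\log n}=1,$$ and for each of the two choices $c_n=n\log n$ and $c_n=t_{mix}^{(n)}(\varepsilon)$ one has $c_n>0$ and $w_n>0$ for all large $n$, $\lim_{n\to\infty}w_n/c_n=0$, and $$\lim_{\alpha\to-\infty}\lim_{n\to\infty}d_n\big(c_n+\alpha w_n\big)=1,\qquad \lim_{\alpha\to\infty}\lim_{n\to\infty}d_n\big(c_n+\alpha w_n\big)=0,$$ where times are rounded down to integers (negative times to $0$), and the inner limits exist for all $\alpha$ sufficiently close to $-\infty$, respectively $+\infty$.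 -/

import Mathlib

open Filter Topology

/-! ### Random walks on finite groups -/

section RandomWalk

variable {G : Type*} [Group G] [Fintype G] [DecidableEq G]

/-- The uniform distribution on the finite group `G`. -/
noncomputable def uniformDist (G : Type*) [Fintype G] : G → ℝ :=
  fun _ => 1 / (Fintype.card G : ℝ)

/-- The `t`-fold convolution power `P^t` of `P`, that is, the law at time `t` of the random walk
generated by `P` and started at the identity. -/
noncomputable def convPow (P : G → ℝ) : ℕ → G → ℝ
  | 0 => fun x => if x = 1 then 1 else 0
  | t + 1 => fun x => ∑ g : G, P (x * g⁻¹) * convPow P t g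

/-- Total variation distance of two distributions. -/
noncomputable def tvDist (P Q : G → ℝ) : ℝ :=
  1 / 2 * ∑ g : G, |P g - Q g|

/-- `d_TV(t) = ‖P^t - U‖_TV`. -/
noncomputable def dTV (P : G → ℝ) (t : ℕ) : ℝ :=
  tvDist (convPow P t) (uniformDist G)

/-- `d_Sep(t) = 1 - min_{g, h} P^t(h g⁻¹) / U(h)`; the infimum is over a finite nonempty set,
hence a minimum. -/
noncomputable def dSep (P : G → ℝ) (t : ℕ) : ℝ :=
  1 - ⨅ p : G × G, convPow P t (p.2 * p.1⁻¹) / uniformDist G p.2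

end RandomWalk

/-! ### Mixing times and cutoff -/

/-- The mixing time `min {t : d t < ε}`. -/
noncomputable def mixingTime (d : ℕ → ℝ) (ε : ℝ) : ℕ :=
  sInf {t : ℕ | d t < ε}

/-- `lim_{α → l} lim_{n → ∞} f α n = a`: the inner limit exists for all `α` that are far enough
along `l`, and, as a function of `α`, it tends to `a` along `l`. -/
def HasIteratedLimit (f : ℝ → ℕ → ℝ) (l : Filter ℝ) (a : ℝ) : Prop :=
  ∃ L : ℝ → ℝ, (∀ᶠ α in l, Tendsto (f α) atTop (𝓝 (L α))) ∧ Tendsto L l (𝓝 a)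

/-- `d n t` is the distance from stationarity of the `n`-th chain at time `t`. The distances drop
from `1` to `0` around the times `c n`, within a window of order `w n = o(c n)`. Real times are
rounded down to integers. -/
structure DropsAround (d : ℕ → ℕ → ℝ) (c w : ℕ → ℝ) : Prop where
  center_pos : ∀ᶠ n in atTop, 0 < c n
  window_pos : ∀ᶠ n in atTop, 0 < w n
  window_small : Tendsto (fun n => w n / c n) atTop (𝓝 0)
  before : HasIteratedLimit (fun α n => d n ⌊c n + α * w n⌋₊) atBot 1
  after : HasIteratedLimit (fun α n => d n ⌊c n + α * w n⌋₊) atTop 0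

/-- A sequence of chains has a cutoff at time `τ n` with window `w n`: for every `ε ∈ (0, 1)` the
mixing times at level `ε` are asymptotically equivalent to `τ n`, and the distances drop from `1`
to `0` within a window of order `w n` around these mixing times and around `τ n` itself. -/
structure HasCutoffAt (d : ℕ → ℕ → ℝ) (τ w : ℕ → ℝ) : Prop where
  drops : DropsAround d τ w
  drops_mixingTime : ∀ ε : ℝ, 0 < ε → ε < 1 →
    DropsAround d (fun n => (mixingTime (d n) ε : ℝ)) w
  mixingTime_equiv : ∀ ε : ℝ, 0 < ε → ε < 1 →
    Tendsto (fun n => (mixingTime (d n) ε : ℝ) / τ n) atTop (𝓝 1)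

/-! ### Generalized symmetric groups -/

/-- The generalized symmetric group `G_{m,n} = ℤ_m ≀ S_n`: the element with colors `k` and
permutation `σ` is the tuple `(ξ^{k_1}, …, ξ^{k_n}, σ)`, where the exponents of the `m`-th root of
unity `ξ` are kept. It stands for the bijection `ξ^a i ↦ ξ^{a + k_i} σ(i)` of the set
`{ξ^a i : 1 ≤ i ≤ n, a ∈ ℤ_m}`. The points `1, …, n` are the elements `0, …, n - 1` of `Fin n`. -/
@[ext]
structure GenSymm (m n : ℕ) where
  color : Fin n → ZMod m
  perm : Equiv.Perm (Fin n)

namespace GenSymm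

variable {m n : ℕ}

/-- The group law `(ξ^{k_i}, σ) (ξ^{k'_i}, σ') = (ξ^{k_i} ξ^{k'_{σ(i)}}, σσ')`, where `σσ'` is
`σ` followed by `σ'` (this is what makes the law associative). -/
instance : Mul (GenSymm m n) :=
  ⟨fun a b => ⟨fun i => a.color i + b.color (a.perm i), a.perm.trans b.perm⟩⟩

instance : One (GenSymm m n) := ⟨⟨fun _ => 0, Equiv.refl _⟩⟩

instance : Inv (GenSymm m n) :=
  ⟨fun a => ⟨fun i => -a.color (a.perm.symm i), a.perm.symm⟩⟩

@[simp] theorem mul_color (a b : GenSymm m n) (i : Fin n) :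
    (a * b).color i = a.color i + b.color (a.perm i) := rfl

@[simp] theorem mul_perm (a b : GenSymm m n) : (a * b).perm = a.perm.trans b.perm := rfl

@[simp] theorem one_color (i : Fin n) : (1 : GenSymm m n).color i = 0 := rfl

@[simp] theorem one_perm : (1 : GenSymm m n).perm = Equiv.refl _ := rfl

@[simp] theorem inv_color (a : GenSymm m n) (i : Fin n) :
    a⁻¹.color i = -a.color (a.perm.symm i) := rfl

@[simp] theorem inv_perm (a : GenSymm m n) : a⁻¹.perm = a.perm.symm := rfl

instance : Group (GenSymm m n) :=
  Group.ofLeftAxioms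
    (fun a b c => by
      ext i
      · simp [add_assoc]
      · simp)
    (fun a => by
      ext i
      · simp
      · simp)
    (fun a => by
      ext i
      · simp
      · simp)

/-- The underlying set is `ℤ_m^n × S_n`. -/
def equivProd (m n : ℕ) : GenSymm m n ≃ (Fin n → ZMod m) × Equiv.Perm (Fin n) where
  toFun a := (a.color, a.perm)
  invFun p := ⟨p.1, p.2⟩
  left_inv _ := rfl
  right_inv _ := rfl

instance : DecidableEq (GenSymm m n) := (equivProd m n).decidableEq

instance [NeZero m] : Fintype (GenSymm m n) := Fintype.ofEquiv _ (equivProd m n).symm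

/-- The element with permutation `(i j)`, color `k` in the places `i` and `j`, and color `0`
elsewhere. For `i = j` it has the trivial permutation and color `k` in the single place `i`. -/
def colorSwap (i j : Fin n) (k : ZMod m) : GenSymm m n :=
  ⟨fun l => if l = i ∨ l = j then k else 0, Equiv.swap i j⟩

end GenSymm

/-- The unbiased one-sided transposition shuffle `OST_{m,n}`: the law of `colorSwap i j k`, where
`j` is uniform on the `n` positions, `i` is uniform on the positions `≤ j`, and `k` is uniform on
`ℤ_m`. Each triple has probability `1 / (n j m)` (with `j + 1` for `j`, as positions in `Fin n` start
at `0`). The triples with `i = j` and `k = 0` all give the identity, and their probabilities add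
up. -/
noncomputable def ostShuffle (m n : ℕ) [NeZero m] : GenSymm m n → ℝ := fun g =>
  ∑ j : Fin n, ∑ i ∈ Finset.Iic j, ∑ k : ZMod m,
    if g = GenSymm.colorSwap i j k then 1 / ((n : ℝ) * ((j : ℕ) + 1 : ℝ) * (m : ℝ)) else 0

/-! Upper bound: coupon collecting. Given the word of right hands of the first `t` steps, the law of
the walk is a product of elements `letter m j` of the group algebra. If every position occurs in the
word, this product is exactly uniform (`list_letter_eq`), so the separation distance is at most the
probability `n (1 - 1/n)^t` bounding the event that some position is missing. This vanishes at `n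
log n + n log log n`.

Exact uniformity has two sources. Letters commute with averages over colors, and the letter of `j`
extends an average over the colors below `j` to position `j` itself; hence a full word absorbs the
average over all colors (`list_letter_mul_colorAvg`). Next to that average the colors of the letters
can be dropped. What remains are the averages of the transpositions `(i j)` with `i ≤ j`, which are
shifted and normalized Jucys–Murphy elements. They commute, and one of each makes a Fisher–Yates
shuffle, uniform on permutations.

Lower bound: a position `≥ c` is touched in a step with probability at most `1/c`. At time `n log n
- 2 n log log n`, the number of untouched positions among roughly the last `n / log n` has mean at
least of order `log n`, and Chebyshev's inequality (`one_sub_le_sum_words`) shows that it is rarely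
small. Untouched positions are fixed points, whereas a uniform element has on average at most one
fixed point there. So the total variation distance tends to `1`.

Since total variation is at most separation, each bound serves both distances; monotonicity in time
yields the cutoff. -/

/-! ### Cutoff from the distances at two times -/

/-- The center `c` lies between `τ - 2w` and `τ + w`, so shifting `a` by `-1` and `b` by `+2`
carries the two limits over from `τ` to `c`. Both inner limits are then constant in `α`. -/
theorem DropsAround.of_antitone {d : ℕ → ℕ → ℝ} {c τ w : ℕ → ℝ} {a b : ℝ}
    (hanti : ∀ᶠ n in atTop, Antitone (d n)) (h0 : ∀ᶠ n in atTop, ∀ t, 0 ≤ d n t)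
    (h1 : ∀ᶠ n in atTop, ∀ t, d n t ≤ 1)
    (hc : ∀ᶠ n in atTop, 0 < c n) (hw : ∀ᶠ n in atTop, 0 < w n)
    (hwc : Tendsto (fun n => w n / c n) atTop (𝓝 0))
    (hlow : ∀ᶠ n in atTop, c n ≤ τ n + w n) (hupp : ∀ᶠ n in atTop, τ n - 2 * w n ≤ c n)
    (hbefore : Tendsto (fun n => d n ⌊τ n + a * w n⌋₊) atTop (𝓝 1))
    (hafter : Tendsto (fun n => d n ⌊τ n + b * w n⌋₊) atTop (𝓝 0)) :
    DropsAround d c w := by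
  refine ⟨hc, hw, hwc, ⟨fun _ => 1, ?_, tendsto_const_nhds⟩, ⟨fun _ => 0, ?_, tendsto_const_nhds⟩⟩
  · filter_upwards [eventually_le_atBot (a - 1)] with α hα
    refine tendsto_of_tendsto_of_tendsto_of_le_of_le' hbefore tendsto_const_nhds ?_ ?_
    · filter_upwards [hanti, hw, hlow] with n hn hwn hl
      refine hn (Nat.floor_le_floor ?_)
      nlinarith [mul_le_mul_of_nonneg_right hα hwn.le]
    · filter_upwards [h1] with n hn using hn _
  · filter_upwards [eventually_ge_atTop (b + 2)] with α hα
    refine tendsto_of_tendsto_of_tendsto_of_le_of_le' tendsto_const_nhds hafter ?_ ?_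
    · filter_upwards [h0] with n hn using hn _
    · filter_upwards [hanti, hw, hupp] with n hn hwn hl
      refine hn (Nat.floor_le_floor ?_)
      nlinarith [mul_le_mul_of_nonneg_right hα hwn.le]

/-- A criterion for cutoff in terms of the distances at two times on either side of `τ n`. -/
theorem HasCutoffAt.of_antitone {d : ℕ → ℕ → ℝ} {τ w : ℕ → ℝ}
    (hanti : ∀ᶠ n in atTop, Antitone (d n)) (h0 : ∀ᶠ n in atTop, ∀ t, 0 ≤ d n t)
    (h1 : ∀ᶠ n in atTop, ∀ t, d n t ≤ 1)
    (hτ : ∀ᶠ n in atTop, 0 < τ n) (hw : ∀ᶠ n in atTop, 0 < w n)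
    (hwτ : Tendsto (fun n => w n / τ n) atTop (𝓝 0))
    (hbefore : Tendsto (fun n => d n ⌊τ n + (-2) * w n⌋₊) atTop (𝓝 1))
    (hafter : Tendsto (fun n => d n ⌊τ n + 1 * w n⌋₊) atTop (𝓝 0)) :
    HasCutoffAt d τ w := by
  have key : ∀ ε : ℝ, 0 < ε → ε < 1 → ∀ᶠ n in atTop,
      τ n - 2 * w n ≤ mixingTime (d n) ε ∧ (mixingTime (d n) ε : ℝ) ≤ τ n + w n := by
    intro ε hε hε1
    filter_upwards [hanti, hτ, hw, hbefore.eventually_const_lt hε1, hafter.eventually_lt_const hε]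
      with n hn hτn hwn hb ha
    have hle : mixingTime (d n) ε ≤ ⌊τ n + 1 * w n⌋₊ := Nat.sInf_le ha
    -- The time after the cutoff shows that the set is nonempty, so `sInf` is attained and is not
    -- its default value `0`.
    have hmem : d n (mixingTime (d n) ε) < ε :=
      Nat.sInf_mem (s := {t : ℕ | d n t < ε}) ⟨_, ha⟩
    constructor
    · by_contra! hlt
      have : mixingTime (d n) ε ≤ ⌊τ n + (-2) * w n⌋₊ := Nat.le_floor (by linarith)
      linarith [hn this]
    · calc (mixingTime (d n) ε : ℝ) ≤ (⌊τ n + 1 * w n⌋₊ : ℝ) := by exact_mod_cast hle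
        _ ≤ τ n + 1 * w n := Nat.floor_le (by linarith)
        _ = _ := by ring
  have equiv : ∀ ε : ℝ, 0 < ε → ε < 1 →
      Tendsto (fun n => (mixingTime (d n) ε : ℝ) / τ n) atTop (𝓝 1) := by
    intro ε hε hε1
    have l1 : Tendsto (fun n => 1 - 2 * (w n / τ n)) atTop (𝓝 1) := by
      simpa using (hwτ.const_mul 2).const_sub 1
    have l2 : Tendsto (fun n => 1 + w n / τ n) atTop (𝓝 1) := by
      simpa using hwτ.const_add 1
    refine tendsto_of_tendsto_of_tendsto_of_le_of_le' l1 l2 ?_ ?_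
    · filter_upwards [key ε hε hε1, hτ] with n hn hτn
      rw [le_div_iff₀ hτn]
      have : (1 - 2 * (w n / τ n)) * τ n = τ n - 2 * w n := by field_simp
      linarith [hn.1]
    · filter_upwards [key ε hε hε1, hτ] with n hn hτn
      rw [div_le_iff₀ hτn]
      have : (1 + w n / τ n) * τ n = τ n + w n := by field_simp
      linarith [hn.2]
  refine ⟨.of_antitone hanti h0 h1 hτ hw hwτ ?_ ?_ hbefore hafter, fun ε hε hε1 => ?_, equiv⟩
  · filter_upwards [hw] with n hn
    linarith
  · filter_upwards [hw] with n hn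
    linarith
  · have hpos : ∀ᶠ n in atTop, 0 < (mixingTime (d n) ε : ℝ) := by
      filter_upwards [(equiv ε hε hε1).eventually_const_lt zero_lt_one, hτ] with n hn hτn
      exact (div_pos_iff_of_pos_right hτn).1 hn
    refine .of_antitone hanti h0 h1 hpos hw ?_ ?_ ?_ hbefore hafter
    · have := hwτ.div (equiv ε hε hε1) one_ne_zero
      rw [zero_div] at this
      refine this.congr' ?_
      filter_upwards [hτ] with n hn
      rw [Pi.div_apply]
      field_simp
    · filter_upwards [key ε hε hε1] with n hn using hn.2
    · filter_upwards [key ε hε hε1] with n hn using hn.1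

/-! ### Total variation and separation for random walks on finite groups -/

/-- The differences sum to zero, so their sum over `A` is minus their sum over the complement; each
is bounded by the absolute values on its side. -/
theorem sum_sub_sum_le_tvDist {G : Type*} [Fintype G] [DecidableEq G] {P Q : G → ℝ}
    (h : ∑ g, P g = ∑ g, Q g) (A : Finset G) :
    ∑ g ∈ A, P g - ∑ g ∈ A, Q g ≤ tvDist P Q := by
  have hA : ∑ g ∈ A, (P g - Q g) ≤ ∑ g ∈ A, |P g - Q g| :=
    Finset.sum_le_sum fun _ _ => le_abs_self _
  have hAc : -∑ g ∈ Aᶜ, (P g - Q g) ≤ ∑ g ∈ Aᶜ, |P g - Q g| := by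
    rw [← Finset.sum_neg_distrib]
    exact Finset.sum_le_sum fun _ _ => neg_le_abs _
  have h0 := Finset.sum_add_sum_compl A fun g => P g - Q g
  have h2 := Finset.sum_add_sum_compl A fun g => |P g - Q g|
  rw [Finset.sum_sub_distrib (s := Finset.univ), h] at h0
  rw [← Finset.sum_sub_distrib]
  unfold tvDist
  linarith

section RandomWalk

variable {G : Type*} [Group G] [Fintype G]

theorem sum_mul_inv_right (f : G → ℝ) (g : G) : ∑ x, f (x * g⁻¹) = ∑ x, f x :=
  Equiv.sum_comp (Equiv.mulRight g⁻¹) f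

theorem sum_mul_inv_left (f : G → ℝ) (x : G) : ∑ g, f (x * g⁻¹) = ∑ g, f g :=
  Equiv.sum_comp ((Equiv.inv G).trans (Equiv.mulLeft x)) f

theorem uniformDist_pos (g : G) : 0 < uniformDist G g := by
  have : 0 < Fintype.card G := Fintype.card_pos
  simp only [uniformDist]
  positivity

theorem sum_uniformDist : ∑ g, uniformDist G g = 1 := by
  simp [uniformDist]

variable [DecidableEq G]

theorem convPow_nonneg {P : G → ℝ} (hP : ∀ g, 0 ≤ P g) (t : ℕ) (g : G) : 0 ≤ convPow P t g := by
  induction t generalizing g with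
  | zero => simp only [convPow]; split_ifs <;> norm_num
  | succ t ih => exact Finset.sum_nonneg fun _ _ => mul_nonneg (hP _) (ih _)

theorem sum_convPow {P : G → ℝ} (h1 : ∑ g, P g = 1) (t : ℕ) : ∑ g, convPow P t g = 1 := by
  induction t with
  | zero => simp [convPow]
  | succ t ih =>
    simp only [convPow]
    rw [Finset.sum_comm]
    simp only [← Finset.sum_mul, sum_mul_inv_right, h1, one_mul, ih]

theorem dTV_nonneg (P : G → ℝ) (t : ℕ) : 0 ≤ dTV P t := by
  unfold dTV tvDist
  positivity

/-- Convolution with `P` fixes the uniform distribution and contracts the `ℓ¹` norm. -/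
theorem antitone_dTV {P : G → ℝ} (hP : ∀ g, 0 ≤ P g) (h1 : ∑ g, P g = 1) :
    Antitone (dTV P) := by
  refine antitone_nat_of_succ_le fun t => ?_
  unfold dTV tvDist
  refine mul_le_mul_of_nonneg_left ?_ (by norm_num)
  calc ∑ x, |convPow P (t + 1) x - uniformDist G x|
      = ∑ x, |∑ g, P (x * g⁻¹) * (convPow P t g - uniformDist G g)| := by
        refine Finset.sum_congr rfl fun x _ => ?_
        have : ∑ g, P (x * g⁻¹) * uniformDist G g = uniformDist G x := by
          simp only [uniformDist, ← Finset.sum_mul, sum_mul_inv_left, h1, one_mul]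
        simp only [convPow, mul_sub, Finset.sum_sub_distrib, this]
    _ ≤ ∑ x, ∑ g, P (x * g⁻¹) * |convPow P t g - uniformDist G g| := by
        refine Finset.sum_le_sum fun x _ => (Finset.abs_sum_le_sum_abs _ _).trans_eq ?_
        simp only [abs_mul, abs_of_nonneg (hP _)]
    _ = _ := by
        rw [Finset.sum_comm]
        simp only [← Finset.sum_mul, sum_mul_inv_right, h1, one_mul]

/-- With `dSep_le_of_forall`, this makes `dSep P t` the least `δ` with `(1 - δ) U ≤ P^t` pointwise.
One group element suffices because `U` is constant. -/
theorem one_sub_dSep_le (P : G → ℝ) (t : ℕ) (g : G) :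
    (1 - dSep P t) * uniformDist G g ≤ convPow P t g := by
  rw [← le_div_iff₀ (uniformDist_pos g)]
  have := ciInf_le (Set.finite_range fun p : G × G =>
    convPow P t (p.2 * p.1⁻¹) / uniformDist G p.2).bddBelow (1, g)
  simpa [dSep] using this

theorem dSep_le_of_forall {P : G → ℝ} {t : ℕ} {δ : ℝ}
    (h : ∀ g, (1 - δ) * uniformDist G g ≤ convPow P t g) : dSep P t ≤ δ := by
  have : 1 - δ ≤ ⨅ p : G × G, convPow P t (p.2 * p.1⁻¹) / uniformDist G p.2 :=
    le_ciInf fun p => (le_div_iff₀ (uniformDist_pos _)).2 <| by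
      simpa only [uniformDist] using h (p.2 * p.1⁻¹)
  unfold dSep
  linarith

theorem dSep_le_one {P : G → ℝ} (hP : ∀ g, 0 ≤ P g) (t : ℕ) : dSep P t ≤ 1 :=
  dSep_le_of_forall fun g => by simpa using convPow_nonneg hP t g

theorem antitone_dSep {P : G → ℝ} (hP : ∀ g, 0 ≤ P g) (h1 : ∑ g, P g = 1) :
    Antitone (dSep P) := by
  refine antitone_nat_of_succ_le fun t => dSep_le_of_forall fun x => ?_
  calc (1 - dSep P t) * uniformDist G x
      = ∑ g, P (x * g⁻¹) * ((1 - dSep P t) * uniformDist G g) := by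
        simp only [uniformDist, ← Finset.sum_mul, sum_mul_inv_left, h1, one_mul]
    _ ≤ _ := Finset.sum_le_sum fun g _ =>
        mul_le_mul_of_nonneg_left (one_sub_dSep_le P t g) (hP _)

theorem dSep_nonneg {P : G → ℝ} (h1 : ∑ g, P g = 1) (t : ℕ) : 0 ≤ dSep P t := by
  have := Finset.sum_le_sum fun g (_ : g ∈ Finset.univ) => one_sub_dSep_le P t g
  rw [← Finset.mul_sum, sum_uniformDist, sum_convPow h1] at this
  linarith

/-- If `x ≥ -s U` with `s, U ≥ 0`, then `|x| ≤ x + 2 s U`. For `x = P^t - U` the first terms sum to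
zero. -/
theorem dTV_le_dSep {P : G → ℝ} (h1 : ∑ g, P g = 1) (t : ℕ) : dTV P t ≤ dSep P t := by
  have hs := dSep_nonneg h1 t
  have habs : ∀ g, |convPow P t g - uniformDist G g| ≤
      (convPow P t g - uniformDist G g) + 2 * (dSep P t * uniformDist G g) := fun g => by
    have h := one_sub_dSep_le P t g
    have h' := mul_nonneg hs (uniformDist_pos g).le
    rw [abs_le]
    constructor <;> linarith
  have := Finset.sum_le_sum fun g (_ : g ∈ Finset.univ) => habs g
  rw [Finset.sum_add_distrib, Finset.sum_sub_distrib, ← Finset.mul_sum, ← Finset.mul_sum,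
    sum_uniformDist, sum_convPow h1] at this
  unfold dTV tvDist
  linarith

end RandomWalk

/-! ### Convolution powers as powers in the group algebra -/

section Algebra

theorem sum_pow_eq_sum_prod_ofFn {R ι : Type*} [Semiring R] [Fintype ι] (f : ι → R) (t : ℕ) :
    (∑ a, f a) ^ t = ∑ w : Fin t → ι, (List.ofFn fun s => f (w s)).prod := by
  induction t with
  | zero => simp
  | succ t ih =>
    rw [pow_succ', ih, Finset.sum_mul_sum, ← Fintype.sum_prod_type',
      ← (Fin.consEquiv fun _ : Fin (t + 1) => ι).sum_comp]
    simp [List.ofFn_succ, Fin.consEquiv]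

theorem prod_ofFn_smul {R A : Type*} [CommSemiring R] [Semiring A] [Algebra R A] {t : ℕ}
    (p : Fin t → R) (f : Fin t → A) :
    (List.ofFn fun s => p s • f s).prod = (∏ s, p s) • (List.ofFn f).prod := by
  induction t with
  | zero => simp
  | succ t ih =>
    rw [List.ofFn_succ, List.ofFn_succ, List.prod_cons, List.prod_cons, ih, Fin.prod_univ_succ,
      smul_mul_smul_comm]

variable {G : Type*} [Group G] [Fintype G]

/-- The element `∑ f(g) g` of the group algebra. -/
noncomputable def groupAlgebraSum (f : G → ℝ) : MonoidAlgebra ℝ G :=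
  ∑ g, f g • MonoidAlgebra.of ℝ G g

theorem coeff_groupAlgebraSum (f : G → ℝ) (g : G) : (groupAlgebraSum f).coeff g = f g := by
  classical
  simp [groupAlgebraSum, MonoidAlgebra.of_apply, Finsupp.single_apply]

theorem groupAlgebraSum_convPow [DecidableEq G] (P : G → ℝ) (t : ℕ) :
    groupAlgebraSum (convPow P t) = groupAlgebraSum P ^ t := by
  induction t with
  | zero => simp [groupAlgebraSum, convPow]; rfl
  | succ t ih =>
    rw [pow_succ', ← ih]
    simp only [groupAlgebraSum, convPow, Finset.sum_smul]
    rw [Finset.sum_comm, Finset.sum_mul_sum]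
    conv_rhs => rw [Finset.sum_comm]
    refine Finset.sum_congr rfl fun g _ => ?_
    rw [← Equiv.sum_comp (Equiv.mulRight g)]
    refine Finset.sum_congr rfl fun a _ => ?_
    simp only [Equiv.coe_mulRight, mul_inv_cancel_right, map_mul, smul_mul_smul_comm]

theorem convPow_eq_coeff [DecidableEq G] (P : G → ℝ) (t : ℕ) (g : G) :
    convPow P t g = (groupAlgebraSum P ^ t).coeff g := by
  rw [← groupAlgebraSum_convPow, coeff_groupAlgebraSum]

end Algebra

namespace GenSymm

variable {m n : ℕ}

/-! ### Relations between colored transpositions -/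

theorem colorSwap_comm (i j : Fin n) (k : ZMod m) : colorSwap i j k = colorSwap j i k := by
  simp only [colorSwap, Equiv.swap_comm i j, or_comm]

theorem colorSwap_self_zero (i : Fin n) : (colorSwap i i 0 : GenSymm m n) = 1 := by
  ext l <;> simp [colorSwap]

theorem colorSwap_self_mul (i : Fin n) (c c' : ZMod m) :
    colorSwap i i c * colorSwap i i c' = colorSwap i i (c + c') := by
  ext l
  · by_cases h : l = i <;> simp [colorSwap, h]
  · simp [colorSwap]

theorem colorSwap_mul_of_ne {i j l : Fin n} (hi : l ≠ i) (hj : l ≠ j) (k c : ZMod m) :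
    colorSwap i j k * colorSwap l l c = colorSwap l l c * colorSwap i j k := by
  ext x
  · by_cases h : x = l
    · subst h
      simp [colorSwap, hi, hj, Equiv.swap_apply_of_ne_of_ne hi hj]
    · have : Equiv.swap i j x ≠ l := fun h' => h <| by
        rw [← Equiv.swap_apply_of_ne_of_ne hi hj] at h'
        exact (Equiv.swap i j).injective h'
      simp [colorSwap, h, this]
      congr
  · simp [colorSwap]

/-- The product has color `k + c` at `i` and `k` at `j`. A colored transposition has equal colors in
both places, so raising its color to `k + c` needs a correction `-c`: at `j` when it stands on the
left, at `i` when it stands on the right (`colorSwap_mul_self'`). -/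
theorem colorSwap_mul_self {i j : Fin n} (h : i ≠ j) (k c : ZMod m) :
    colorSwap i j k * colorSwap j j c = colorSwap j j (-c) * colorSwap i j (k + c) := by
  ext x
  · by_cases hi : x = i
    · subst hi
      simp [colorSwap, h]
    · by_cases hj : x = j
      · subst hj
        simp [colorSwap, h]
      · simp [colorSwap, hi, hj, Equiv.swap_apply_of_ne_of_ne hi hj]
  · simp [colorSwap]

theorem colorSwap_mul_self' {i j : Fin n} (h : i ≠ j) (k c : ZMod m) :
    colorSwap i j k * colorSwap j j c = colorSwap i j (k + c) * colorSwap i i (-c) := by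
  ext x
  · by_cases hi : x = i
    · subst hi
      simp [colorSwap, h.symm]
    · by_cases hj : x = j
      · subst hj
        simp [colorSwap, h]
      · simp [colorSwap, hi, hj, Equiv.swap_apply_of_ne_of_ne hi hj]
  · simp [colorSwap]

theorem colorSwap_eq_mul {i j : Fin n} (h : i ≠ j) (k : ZMod m) :
    colorSwap i j k = colorSwap i j 0 * (colorSwap i i k * colorSwap j j k) := by
  ext x
  · by_cases hi : x = i
    · subst hi
      simp [colorSwap, h.symm]
    · by_cases hj : x = j
      · subst hj
        simp [colorSwap, h]
      · simp [colorSwap, hi, hj, Equiv.swap_apply_of_ne_of_ne hi hj]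
  · simp [colorSwap]

/-- The element with permutation `σ` and all colors `0`. -/
def ofPerm (m : ℕ) (σ : Equiv.Perm (Fin n)) : GenSymm m n := ⟨fun _ => 0, σ⟩

theorem ofPerm_mul (σ τ : Equiv.Perm (Fin n)) : ofPerm m σ * ofPerm m τ = ofPerm m (τ * σ) := by
  ext <;> simp [ofPerm]

theorem ofPerm_one : ofPerm m (1 : Equiv.Perm (Fin n)) = 1 := rfl

theorem colorSwap_zero (i j : Fin n) :
    (colorSwap i j 0 : GenSymm m n) = ofPerm m (Equiv.swap i j) := by
  simp [colorSwap, ofPerm]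

/-- The colors of single positions and the transpositions generate the group. -/
theorem mem_of_generators (H : Submonoid (GenSymm m n))
    (hc : ∀ i c, colorSwap i i c ∈ H) (hs : ∀ i j, colorSwap i j 0 ∈ H) (g : GenSymm m n) :
    g ∈ H := by
  have hperm : ∀ σ : Equiv.Perm (Fin n), ofPerm m σ ∈ H := fun σ => by
    induction σ using Equiv.Perm.swap_induction_on with
    | one => exact H.one_mem
    | swap_mul f x y _ hf =>
      rw [← ofPerm_mul, ← colorSwap_zero]
      exact H.mul_mem hf (hs x y)
  have hcol : ∀ s : Finset (Fin n),
      (⟨fun i => if i ∈ s then g.color i else 0, 1⟩ : GenSymm m n) ∈ H := fun s => by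
    induction s using Finset.induction_on with
    | empty => exact H.one_mem
    | insert a s ha ih =>
      convert H.mul_mem (hc a (g.color a)) ih using 1
      ext x
      · by_cases hx : x = a
        · subst hx
          simp [colorSwap, ha]
        · simp [colorSwap, hx]
          congr
      · simp [colorSwap]
  convert H.mul_mem (hcol Finset.univ) (hperm g.perm) using 1
  ext x <;> simp [ofPerm]

end GenSymm

/-! ### Letters absorb averages over colors -/

namespace GenSymm

variable {m n : ℕ} [NeZero m]

/-- The basis element of the group algebra that belongs to a group element. -/
noncomputable abbrev point : GenSymm m n →* MonoidAlgebra ℝ (GenSymm m n) :=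
  MonoidAlgebra.of ℝ (GenSymm m n)

/-- The sum of the colored transpositions of two given positions. -/
noncomputable def swapSum (i j : Fin n) : MonoidAlgebra ℝ (GenSymm m n) :=
  ∑ k : ZMod m, point (colorSwap i j k)

theorem swapSum_comm (i j : Fin n) : (swapSum i j : MonoidAlgebra ℝ (GenSymm m n)) = swapSum j i := by
  simp only [swapSum, colorSwap_comm i j]

theorem point_mul_swapSum_self (i : Fin n) (c : ZMod m) :
    point (colorSwap i i c) * swapSum i i = swapSum i i := by
  simp only [swapSum, Finset.mul_sum, ← map_mul, colorSwap_self_mul]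
  exact Equiv.sum_comp (Equiv.addLeft c) fun k => point (colorSwap i i k)

theorem swapSum_self_mul_point (i : Fin n) (c : ZMod m) :
    swapSum i i * point (colorSwap i i c) = swapSum i i := by
  simp only [swapSum, Finset.sum_mul, ← map_mul, colorSwap_self_mul]
  exact Equiv.sum_comp (Equiv.addRight c) fun k => point (colorSwap i i k)

/-- Summing over `k` hides the shift by `c`; only the correction `-c` survives. -/
theorem swapSum_mul_point (i j : Fin n) (c : ZMod m) :
    swapSum i j * point (colorSwap j j c) = point (colorSwap j j (-c)) * swapSum i j := by
  by_cases h : i = j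
  · rw [h, swapSum_self_mul_point, point_mul_swapSum_self]
  · simp only [swapSum, Finset.sum_mul, Finset.mul_sum, ← map_mul, colorSwap_mul_self h]
    exact Equiv.sum_comp (Equiv.addRight c)
      fun k => point (colorSwap j j (-c) * colorSwap i j k)

theorem swapSum_mul_point' {i j : Fin n} (h : i ≠ j) (c : ZMod m) :
    swapSum i j * point (colorSwap j j c) = swapSum i j * point (colorSwap i i (-c)) := by
  simp only [swapSum, Finset.sum_mul, ← map_mul, colorSwap_mul_self' h]
  exact Equiv.sum_comp (Equiv.addRight c)
    fun k => point (colorSwap i j k * colorSwap i i (-c))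

/-- A color at `j` passes through `swapSum i j` with its sign reversed, which is invisible after
summing over all colors. The case of `i` follows by symmetry, and other positions are disjoint from
the transposition. -/
theorem commute_swapSum (i j l : Fin n) :
    Commute (swapSum i j) (swapSum l l : MonoidAlgebra ℝ (GenSymm m n)) := by
  have key : ∀ i j : Fin n,
      Commute (swapSum i j) (swapSum j j : MonoidAlgebra ℝ (GenSymm m n)) := fun i j => by
    change _ * _ = _ * _
    conv_lhs => rw [swapSum.eq_1 j j, Finset.mul_sum]
    conv_rhs => rw [swapSum.eq_1 j j, Finset.sum_mul]
    simp only [swapSum_mul_point]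
    exact Equiv.sum_comp (Equiv.neg (ZMod m)) fun k => point (colorSwap j j k) * swapSum i j
  by_cases hj : l = j
  · exact hj ▸ key i j
  by_cases hi : l = i
  · subst hi
    rw [swapSum_comm]
    exact key j l
  refine Commute.sum_left _ _ _ fun k _ => Commute.sum_right _ _ _ fun c _ => ?_
  change _ * _ = _ * _
  rw [← map_mul, ← map_mul, colorSwap_mul_of_ne hi hj]

/-- The average over the color vectors that are supported on the positions below `a`. -/
noncomputable def colorAvg (m n : ℕ) [NeZero m] : ℕ → MonoidAlgebra ℝ (GenSymm m n)
  | 0 => 1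
  | a + 1 => colorAvg m n a * if h : a < n then (1 / (m : ℝ)) • swapSum ⟨a, h⟩ ⟨a, h⟩ else 1

theorem commute_swapSum_colorAvg (i j : Fin n) (a : ℕ) :
    Commute (swapSum i j) (colorAvg m n a) := by
  induction a with
  | zero => exact Commute.one_right _
  | succ a ih =>
    refine ih.mul_right ?_
    split_ifs
    · exact (commute_swapSum i j _).smul_right _
    · exact Commute.one_right _

theorem colorAvg_mul_point (i : Fin n) (c : ZMod m) {a : ℕ} (h : (i : ℕ) < a) :
    colorAvg m n a * point (colorSwap i i c) = colorAvg m n a := by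
  induction a with
  | zero => omega
  | succ a ih =>
    simp only [colorAvg]
    rcases Nat.lt_succ_iff_lt_or_eq.1 h with hi | hi
    · have : Commute (colorAvg m n a)
          (if h : a < n then (1 / (m : ℝ)) • swapSum ⟨a, h⟩ ⟨a, h⟩ else 1) := by
        split_ifs
        · exact ((commute_swapSum_colorAvg _ _ a).smul_left _).symm
        · exact Commute.one_right _
      rw [this.eq, mul_assoc, ih hi]
    · have ha : a < n := hi ▸ i.2
      have : i = ⟨a, ha⟩ := Fin.ext hi
      subst this
      rw [dif_pos ha, mul_assoc, smul_mul_assoc, swapSum_self_mul_point]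

theorem point_mul_colorAvg (i : Fin n) (c : ZMod m) {a : ℕ} (h : (i : ℕ) < a) :
    point (colorSwap i i c) * colorAvg m n a = colorAvg m n a := by
  induction a with
  | zero => omega
  | succ a ih =>
    simp only [colorAvg]
    rcases Nat.lt_succ_iff_lt_or_eq.1 h with hi | hi
    · rw [← mul_assoc, ih hi]
    · have ha : a < n := hi ▸ i.2
      have : i = ⟨a, ha⟩ := Fin.ext hi
      subst this
      rw [dif_pos ha, ← ((commute_swapSum_colorAvg _ _ _).smul_left _).eq, ← mul_assoc,
        mul_smul_comm, point_mul_swapSum_self]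

/-- For `i < j`, a color at `j` becomes the opposite color at `i`, which the average below `j`
absorbs. For `i = j` the sum over `k` absorbs it. -/
theorem swapSum_mul_colorAvg_succ {i j : Fin n} (h : i ≤ j) :
    swapSum i j * colorAvg m n (j + 1) = swapSum i j * colorAvg m n j := by
  have key : ∀ c, swapSum i j * colorAvg m n j * point (colorSwap j j c) =
      swapSum i j * colorAvg m n j := fun c => by
    rw [(commute_swapSum_colorAvg i j j).eq, mul_assoc]
    rcases eq_or_lt_of_le h with rfl | hlt
    · rw [swapSum_self_mul_point]
    · rw [swapSum_mul_point' hlt.ne, ← mul_assoc, ← (commute_swapSum_colorAvg i j j).eq,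
        mul_assoc, colorAvg_mul_point i _ hlt]
  simp only [colorAvg, j.2, dite_true]
  rw [← mul_assoc, mul_smul_comm]
  conv_lhs => rw [swapSum.eq_1 j j, Finset.mul_sum]
  have hm : (m : ℝ) ≠ 0 := Nat.cast_ne_zero.2 (NeZero.ne m)
  simp only [key, Finset.sum_const, Finset.card_univ, ZMod.card, ← Nat.cast_smul_eq_nsmul ℝ,
    smul_smul, one_div_mul_cancel hm, one_smul]

/-- The law of a step of the shuffle that uses the position `j` as the right hand. -/
noncomputable def letter (m : ℕ) [NeZero m] (j : Fin n) : MonoidAlgebra ℝ (GenSymm m n) :=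
  (1 / (((j : ℕ) + 1 : ℝ) * m)) • ∑ i ∈ Finset.Iic j, swapSum i j

theorem commute_letter_colorAvg (j : Fin n) (a : ℕ) : Commute (letter m j) (colorAvg m n a) :=
  (Commute.sum_left _ _ _ fun i _ => commute_swapSum_colorAvg i j a).smul_left _

theorem letter_mul_colorAvg_succ (j : Fin n) :
    letter m j * colorAvg m n (j + 1) = letter m j * colorAvg m n j := by
  simp only [letter, smul_mul_assoc, Finset.sum_mul]
  congr 1
  exact Finset.sum_congr rfl fun i hi => swapSum_mul_colorAvg_succ (Finset.mem_Iic.1 hi)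

theorem commute_list_letter_colorAvg (w : List (Fin n)) (a : ℕ) :
    Commute (w.map (letter m)).prod (colorAvg m n a) :=
  Commute.list_prod_left _ _ fun x hx => by
    obtain ⟨j, -, rfl⟩ := List.mem_map.1 hx
    exact commute_letter_colorAvg j a

/-- Induction on `a`: the average commutes with all letters, so it can be moved next to an
occurrence of the letter of `a`, where the averages below `a + 1` and below `a` have the same
effect. -/
theorem list_letter_mul_colorAvg (w : List (Fin n)) {a : ℕ} (ha : a ≤ n)
    (h : ∀ j : Fin n, (j : ℕ) < a → j ∈ w) :
    (w.map (letter m)).prod * colorAvg m n a = (w.map (letter m)).prod := by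
  induction a with
  | zero => simp [colorAvg]
  | succ a ih =>
    have ih := ih (by omega) fun j hj => h j (by omega)
    obtain ⟨u, v, rfl⟩ := List.append_of_mem (h ⟨a, ha⟩ (Nat.lt_succ_self a))
    simp only [List.map_append, List.map_cons, List.prod_append, List.prod_cons] at ih ⊢
    have hv := commute_list_letter_colorAvg (m := m) v
    calc _ = (u.map (letter m)).prod * (letter m ⟨a, ha⟩ * colorAvg m n (a + 1) *
          (v.map (letter m)).prod) := by
            rw [mul_assoc, mul_assoc, mul_assoc, (hv (a + 1)).eq]
      _ = (u.map (letter m)).prod * (letter m ⟨a, ha⟩ * colorAvg m n a *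
          (v.map (letter m)).prod) := by
            rw [letter_mul_colorAvg_succ (⟨a, ha⟩ : Fin n)]
      _ = _ := by
        rw [mul_assoc (letter m _), ← (hv a).eq]
        simpa only [mul_assoc] using ih

/-! ### Letters without colors and the Fisher–Yates shuffle -/

/-- The average of the transpositions of `j` with the positions up to `j`, all without colors. -/
noncomputable def uncoloredLetter (m : ℕ) [NeZero m] (j : Fin n) :
    MonoidAlgebra ℝ (GenSymm m n) :=
  (1 / ((j : ℕ) + 1 : ℝ)) • ∑ i ∈ Finset.Iic j, point (colorSwap i j 0)

theorem swapSum_mul_colorAvg (i j : Fin n) :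
    swapSum i j * colorAvg m n n = (m : ℝ) • (point (colorSwap i j 0) * colorAvg m n n) := by
  have key : ∀ k : ZMod m, point (colorSwap i j k) * colorAvg m n n =
      point (colorSwap i j 0) * colorAvg m n n := fun k => by
    by_cases h : i = j
    · subst h
      rw [point_mul_colorAvg i _ i.2, point_mul_colorAvg i _ i.2]
    · rw [colorSwap_eq_mul h, map_mul, map_mul, mul_assoc, mul_assoc, point_mul_colorAvg j _ j.2,
        point_mul_colorAvg i _ i.2]
  simp only [swapSum, Finset.sum_mul, key, Finset.sum_const, Finset.card_univ, ZMod.card,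
    ← Nat.cast_smul_eq_nsmul ℝ]

theorem letter_mul_colorAvg (j : Fin n) :
    letter m j * colorAvg m n n = uncoloredLetter m j * colorAvg m n n := by
  have hm : (m : ℝ) ≠ 0 := Nat.cast_ne_zero.2 (NeZero.ne m)
  simp only [letter, uncoloredLetter, smul_mul_assoc, Finset.sum_mul, swapSum_mul_colorAvg,
    ← Finset.smul_sum, smul_smul]
  congr 1
  field_simp

theorem list_letter_mul_colorAvg_eq (w : List (Fin n)) :
    (w.map (letter m)).prod * colorAvg m n n =
      (w.map (uncoloredLetter m)).prod * colorAvg m n n := by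
  induction w with
  | nil => rfl
  | cons j w ih =>
    simp only [List.map_cons, List.prod_cons]
    rw [mul_assoc, (commute_list_letter_colorAvg w n).eq, ← mul_assoc, letter_mul_colorAvg,
      mul_assoc, ← (commute_list_letter_colorAvg w n).eq, ih, mul_assoc]

/-- Conjugation by `(a b)` fixes `j` and permutes the positions `i ≤ j`, hence the summands `(i j)`.
-/
theorem commute_point_uncoloredLetter {a b j : Fin n} (ha : a < j) (hb : b < j) :
    Commute (point (colorSwap a b 0)) (uncoloredLetter m j) := by
  refine Commute.smul_right ?_ _
  change _ * _ = _ * _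
  have hswap : ∀ i, Equiv.swap a b i ≤ j ↔ i ≤ j := fun i => by
    rcases eq_or_ne i a with rfl | hia
    · simp [ha.le, hb.le]
    rcases eq_or_ne i b with rfl | hib
    · simp [ha.le, hb.le]
    rw [Equiv.swap_apply_of_ne_of_ne hia hib]
  rw [Finset.mul_sum, Finset.sum_mul]
  refine Finset.sum_equiv (Equiv.swap a b) (fun i => ?_) fun i _ => ?_
  · simp [hswap]
  · rw [← map_mul, ← map_mul]
    simp only [colorSwap_zero, ofPerm_mul]
    rw [Equiv.mul_swap_eq_swap_mul (Equiv.swap a b) (Equiv.swap a b i) j, Equiv.swap_apply_self,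
      Equiv.swap_apply_of_ne_of_ne ha.ne' hb.ne']

theorem commute_uncoloredLetter (i j : Fin n) :
    Commute (uncoloredLetter m i) (uncoloredLetter m j) := by
  have key : ∀ i j : Fin n, i < j → Commute (uncoloredLetter m i) (uncoloredLetter m j) :=
    fun i j h => (Commute.sum_left _ _ _ fun a ha =>
      commute_point_uncoloredLetter ((Finset.mem_Iic.1 ha).trans_lt h) h).smul_left _
  rcases lt_trichotomy i j with h | rfl | h
  · exact key i j h
  · exact Commute.refl _
  · exact (key j i h).symm

/-- The elements `(i j)` with `i ≤ j` represent the cosets of the permutations of the positions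
below `j` in those of the positions up to `j`. Concretely, `(a j)` exchanges the terms `i = a` and
`i = j`, and moves past any other `(i j)` as `(i a)`, which `x` absorbs. -/
theorem point_mul_uncoloredLetter_mul {j : Fin n} {x : MonoidAlgebra ℝ (GenSymm m n)}
    (hx : ∀ a b : Fin n, a < j → b < j → point (colorSwap a b 0) * x = x) {a b : Fin n}
    (ha : a ≤ j) (hb : b ≤ j) :
    point (colorSwap a b 0) * (uncoloredLetter m j * x) = uncoloredLetter m j * x := by
  have key : ∀ a < j, point (colorSwap a j 0) * (uncoloredLetter m j * x) =
      uncoloredLetter m j * x := fun a ha => by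
    simp only [uncoloredLetter, smul_mul_assoc, mul_smul_comm]
    congr 1
    rw [Finset.sum_mul, Finset.mul_sum]
    refine Finset.sum_equiv (Equiv.swap a j) (fun i => ?_) fun i hi => ?_
    · rcases eq_or_ne i a with rfl | hia
      · simp [ha.le]
      rcases eq_or_ne i j with rfl | hij
      · simp [ha.le]
      rw [Equiv.swap_apply_of_ne_of_ne hia hij]
    · rw [← mul_assoc, ← map_mul]
      rcases eq_or_ne i a with rfl | hia
      · rw [Equiv.swap_apply_left, colorSwap_self_zero, colorSwap_zero, ofPerm_mul,
          Equiv.swap_mul_self, ofPerm_one]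
      rcases eq_or_ne i j with rfl | hij
      · rw [Equiv.swap_apply_right, colorSwap_self_zero, mul_one]
      have e : (colorSwap a j 0 * colorSwap i j 0 : GenSymm m n) =
          colorSwap i j 0 * colorSwap i a 0 := by
        rw [colorSwap_zero, colorSwap_zero, colorSwap_zero, ofPerm_mul, ofPerm_mul,
          Equiv.mul_swap_eq_swap_mul, Equiv.swap_apply_right,
          Equiv.swap_apply_of_ne_of_ne hia.symm ha.ne, Equiv.swap_comm a i]
      rw [Equiv.swap_apply_of_ne_of_ne hia hij, e, map_mul, mul_assoc,
        hx i a (lt_of_le_of_ne (Finset.mem_Iic.1 hi) hij) ha]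
  rcases eq_or_lt_of_le ha with rfl | ha'
  · rcases eq_or_lt_of_le hb with rfl | hb'
    · rw [colorSwap_self_zero, map_one, one_mul]
    · rw [colorSwap_comm]
      exact key b hb'
  · rcases eq_or_lt_of_le hb with rfl | hb'
    · exact key a ha'
    · rw [← mul_assoc, (commute_point_uncoloredLetter ha' hb').eq, mul_assoc, hx a b ha' hb']

/-- As the letters commute, one copy of the letter of the top position can be brought to the front;
the rest of the word still contains all lower positions. -/
theorem point_mul_list_uncoloredLetter (w : List (Fin n)) {c : ℕ} (hc : c ≤ n)
    (h : ∀ j : Fin n, (j : ℕ) < c → j ∈ w) {a b : Fin n} (ha : (a : ℕ) < c) (hb : (b : ℕ) < c) :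
    point (colorSwap a b 0) * (w.map (uncoloredLetter m)).prod =
      (w.map (uncoloredLetter m)).prod := by
  induction c generalizing w a b with
  | zero => omega
  | succ c ih =>
    have hperm := List.perm_cons_erase (h ⟨c, hc⟩ (Nat.lt_succ_self c))
    have : (w.map (uncoloredLetter m)).prod = uncoloredLetter m ⟨c, hc⟩ *
        ((w.erase ⟨c, hc⟩).map (uncoloredLetter m)).prod := by
      rw [← List.prod_cons, ← List.map_cons]
      refine (hperm.map _).prod_eq' (List.pairwise_of_forall_mem_list ?_)
      intro x hx y hy
      obtain ⟨i, -, rfl⟩ := List.mem_map.1 hx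
      obtain ⟨j, -, rfl⟩ := List.mem_map.1 hy
      exact commute_uncoloredLetter i j
    rw [this]
    refine point_mul_uncoloredLetter_mul (fun a b ha hb => ?_) (Nat.lt_succ_iff.1 ha)
      (Nat.lt_succ_iff.1 hb)
    refine ih _ (by omega) (fun j hj => ?_) ha hb
    exact (List.mem_erase_of_ne (by rintro rfl; simp at hj)).2 (h j (by omega))

/-- A word that contains every position as a right hand produces the uniform distribution. -/
theorem list_letter_eq (w : List (Fin n)) (h : ∀ j, j ∈ w) :
    (w.map (letter m)).prod = groupAlgebraSum (uniformDist (GenSymm m n)) := by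
  set x := (w.map (letter m)).prod with hx
  have hE := list_letter_mul_colorAvg (m := m) w le_rfl fun j _ => h j
  -- It suffices to check generators. Colors are absorbed by the color average, which can be put in
  -- front of `x`; transpositions by the uncolored word.
  have inv : ∀ g, point g * x = x := by
    let H : Submonoid (GenSymm m n) :=
      { carrier := {g | point g * x = x}
        one_mem' := by
          change point 1 * x = x
          rw [map_one, one_mul]
        mul_mem' := fun {a b} ha hb => by
          change point (a * b) * x = x
          change point a * x = x at ha
          change point b * x = x at hb
          rw [map_mul, mul_assoc, hb, ha] }
    refine mem_of_generators H (fun i c => ?_) fun i j => ?_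
    · change point _ * x = x
      rw [hx, ← hE, (commute_list_letter_colorAvg w n).eq, ← mul_assoc, point_mul_colorAvg i c i.2]
    · change point _ * x = x
      rw [hx, ← hE, list_letter_mul_colorAvg_eq, ← mul_assoc,
        point_mul_list_uncoloredLetter w le_rfl (fun j _ => h j) i.2 j.2]
  have hright : ∀ g : GenSymm m n, (∑ a, point a) * point g = ∑ a, point a := fun g => by
    simp only [Finset.sum_mul, ← map_mul]
    exact Equiv.sum_comp (Equiv.mulRight g) fun a => point a
  have hletter : ∀ j : Fin n, (∑ a, point a) * letter m j = ∑ a, point a := fun j => by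
    have hm : (m : ℝ) ≠ 0 := Nat.cast_ne_zero.2 (NeZero.ne m)
    simp only [letter, swapSum, mul_smul_comm, Finset.mul_sum, hright, Finset.sum_const,
      Finset.card_univ, ZMod.card, Fin.card_Iic, ← Nat.cast_smul_eq_nsmul ℝ, smul_smul]
    convert one_smul ℝ (∑ a : GenSymm m n, point a)
    push_cast
    field_simp
  have hw : ∀ v : List (Fin n), (∑ a, point a) * (v.map (letter m)).prod = ∑ a, point a :=
    fun v => by
      induction v with
      | nil => simp
      | cons j v ih => rw [List.map_cons, List.prod_cons, ← mul_assoc, hletter, ih]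
  have hcard : (Fintype.card (GenSymm m n) : ℝ) ≠ 0 := Nat.cast_ne_zero.2 Fintype.card_ne_zero
  -- The sum of all group elements times `x` is that sum itself, and by left invariance also `|G|
  -- x`.
  have := hw w
  rw [← hx, Finset.sum_mul] at this
  simp only [inv, Finset.sum_const, Finset.card_univ, ← Nat.cast_smul_eq_nsmul ℝ] at this
  simp only [groupAlgebraSum, uniformDist, ← Finset.smul_sum]
  rw [← this, smul_smul, one_div_mul_cancel hcard, one_smul]

/-! ### The separation distance -/

theorem groupAlgebraSum_ostShuffle :
    groupAlgebraSum (ostShuffle m n) = ∑ j, (1 / (n : ℝ)) • letter m j := by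
  simp only [groupAlgebraSum, ostShuffle, letter, swapSum, Finset.sum_smul, Finset.smul_sum]
  rw [Finset.sum_comm]
  refine Finset.sum_congr rfl fun j _ => ?_
  rw [Finset.sum_comm]
  refine Finset.sum_congr rfl fun i _ => ?_
  rw [Finset.sum_comm]
  refine Finset.sum_congr rfl fun k _ => ?_
  simp only [ite_smul, zero_smul, Finset.sum_ite_eq', Finset.mem_univ, if_true, smul_smul]
  congr 1
  rw [one_div_mul_one_div, mul_assoc]

theorem coeff_letter_mul_nonneg (j : Fin n) {x : MonoidAlgebra ℝ (GenSymm m n)}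
    (hx : ∀ g, 0 ≤ x.coeff g) (g : GenSymm m n) : 0 ≤ (letter m j * x).coeff g := by
  simp only [letter, swapSum, smul_mul_assoc, Finset.sum_mul, MonoidAlgebra.coeff_smul_apply,
    MonoidAlgebra.coeff_sum, Finsupp.finsetSum_apply, MonoidAlgebra.of_apply,
    MonoidAlgebra.coeff_single_mul_apply, smul_eq_mul, one_mul]
  refine mul_nonneg (by positivity) ?_
  exact Finset.sum_nonneg fun _ _ => Finset.sum_nonneg fun _ _ => hx _

theorem coeff_list_letter_nonneg (w : List (Fin n)) (g : GenSymm m n) :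
    0 ≤ (w.map (letter m)).prod.coeff g := by
  induction w generalizing g with
  | nil =>
    simp only [List.map_nil, List.prod_nil, MonoidAlgebra.one_def, MonoidAlgebra.coeff_single,
      Finsupp.single_apply]
    split_ifs <;> norm_num
  | cons j w ih =>
    rw [List.map_cons, List.prod_cons]
    exact coeff_letter_mul_nonneg j ih g

end GenSymm

theorem card_not_surjective_le (n t : ℕ) :
    (Finset.univ.filter fun w : Fin t → Fin n => ¬ Function.Surjective w).card ≤
      n * (n - 1) ^ t := by
  have hsub : (Finset.univ.filter fun w : Fin t → Fin n => ¬ Function.Surjective w) ⊆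
      Finset.univ.biUnion fun j : Fin n =>
        Fintype.piFinset fun _ : Fin t => Finset.univ.erase j := fun w hw => by
    simp only [Finset.mem_filter, Finset.mem_univ, true_and, Function.Surjective, not_forall,
      not_exists] at hw
    simpa [Fintype.mem_piFinset] using hw
  refine (Finset.card_le_card hsub).trans (Finset.card_biUnion_le.trans ?_)
  simp

-- Words of right hands that hit every position contribute exactly the uniform distribution; the
-- others have nonnegative coefficients and are discarded. A union bound counts them.
open GenSymm in
theorem dSep_ostShuffle_le (m : ℕ) [NeZero m] {n : ℕ} (hn : 1 ≤ n) (t : ℕ) :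
    dSep (ostShuffle m n) t ≤ n * (1 - 1 / (n : ℝ)) ^ t := by
  classical
  refine dSep_le_of_forall fun g => ?_
  have hn0 : (n : ℝ) ≠ 0 := by positivity
  rw [convPow_eq_coeff, groupAlgebraSum_ostShuffle, sum_pow_eq_sum_prod_ofFn]
  have hword : ∀ w : Fin t → Fin n, (List.ofFn fun s => (1 / (n : ℝ)) • letter m (w s)).prod =
      (1 / (n : ℝ)) ^ t • ((List.ofFn w).map (letter m)).prod := fun w => by
    rw [prod_ofFn_smul, List.map_ofFn, Finset.prod_const, Finset.card_univ, Fintype.card_fin]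
    rfl
  simp only [hword, ← Finset.smul_sum, MonoidAlgebra.coeff_smul_apply, MonoidAlgebra.coeff_sum,
    Finsupp.finsetSum_apply, smul_eq_mul]
  have hsurj := Finset.sum_le_sum_of_subset_of_nonneg
    (Finset.filter_subset (fun w : Fin t → Fin n => Function.Surjective w) Finset.univ)
    fun w _ _ => coeff_list_letter_nonneg (m := m) (List.ofFn w) g
  have hval : ∀ w ∈ Finset.univ.filter (fun w : Fin t → Fin n => Function.Surjective w),
      ((List.ofFn w).map (letter m)).prod.coeff g = uniformDist (GenSymm m n) g := fun w hw => by
    rw [list_letter_eq _ fun j => by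
      simpa [List.mem_ofFn] using (Finset.mem_filter.1 hw).2 j, coeff_groupAlgebraSum]
  rw [Finset.sum_congr rfl hval, Finset.sum_const, nsmul_eq_mul] at hsurj
  have hcard : (n : ℝ) ^ t - n * (n - 1) ^ t ≤
      ((Finset.univ.filter fun w : Fin t → Fin n => Function.Surjective w).card : ℝ) := by
    have h1 := Finset.card_filter_add_card_filter_not (s := Finset.univ)
      (fun w : Fin t → Fin n => Function.Surjective w)
    rw [Finset.card_univ, Fintype.card_fun, Fintype.card_fin, Fintype.card_fin] at h1
    have h2 : ((Finset.univ.filter fun w : Fin t → Fin n => ¬ Function.Surjective w).card : ℝ) ≤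
        n * (n - 1) ^ t := by
      have := card_not_surjective_le n t
      rw [← Nat.cast_le (α := ℝ)] at this
      push_cast [Nat.cast_sub hn] at this
      exact this
    have h3 : ((Finset.univ.filter fun w : Fin t → Fin n => Function.Surjective w).card : ℝ) +
        ((Finset.univ.filter fun w : Fin t → Fin n => ¬ Function.Surjective w).card : ℝ) =
        (n : ℝ) ^ t := by exact_mod_cast h1
    linarith
  have hpow : 1 - n * (1 - 1 / (n : ℝ)) ^ t =
      (1 / (n : ℝ)) ^ t * ((n : ℝ) ^ t - n * (n - 1) ^ t) := by
    rw [one_sub_div hn0, div_pow, div_pow, one_pow]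
    field_simp
  rw [hpow, mul_assoc]
  refine mul_le_mul_of_nonneg_left ?_ (by positivity)
  exact (mul_le_mul_of_nonneg_right hcard (uniformDist_pos g).le).trans hsurj

/-! ### A second moment bound for words -/

section SecondMoment

variable {Ω ι : Type*} [Fintype Ω]

theorem sum_prod_mul_prod (p f : Ω → ℝ) (t : ℕ) :
    ∑ w : Fin t → Ω, (∏ s, p (w s)) * ∏ s, f (w s) = (∑ a, p a * f a) ^ t := by
  rw [Fintype.sum_pow]
  simp only [Finset.prod_mul_distrib]

/-- Chebyshev's inequality for the number of indices `i ∈ T` for which all letters of a random word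
satisfy the `i`-th condition. -/
theorem one_sub_le_sum_words {p : Ω → ℝ} (hp : ∀ a, 0 ≤ p a) (hp1 : ∑ a, p a = 1)
    (T : Finset ι) (u : ι → Ω → ℝ) (hu : ∀ i a, u i a = 0 ∨ u i a = 1)
    {β η : ℝ} (hβ : 0 < β) (hη : 0 ≤ η) (hq : ∀ i ∈ T, β ≤ ∑ a, p a * u i a)
    (hq2 : ∀ i ∈ T, ∀ l ∈ T, i ≠ l →
      ∑ a, p a * (u i a * u l a) ≤ (∑ a, p a * u i a) * (∑ a, p a * u l a) + η)
    (t : ℕ) {ν : ℝ} (hν : 0 < ν) (hνT : ν ≤ T.card * β ^ t) :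
    1 - (4 / ν + 4 * (Real.exp (t * (η / β ^ 2)) - 1)) ≤
      ∑ w : Fin t → Ω with ν / 2 ≤ ∑ i ∈ T, ∏ s, u i (w s), ∏ s, p (w s) := by
  classical
  set q : ι → ℝ := fun i => ∑ a, p a * u i a
  set μ := ∑ i ∈ T, q i ^ t with hμ
  set N : (Fin t → Ω) → ℝ := fun w => ∑ i ∈ T, ∏ s, u i (w s) with hN
  set W : (Fin t → Ω) → ℝ := fun w => ∏ s, p (w s) with hW
  have hW0 : ∀ w, 0 ≤ W w := fun w => Finset.prod_nonneg fun _ _ => hp _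
  have hW1 : ∑ w, W w = 1 := by rw [← Fintype.sum_pow, hp1, one_pow]
  have hνμ : ν ≤ μ := hνT.trans <| by
    rw [← nsmul_eq_mul]
    exact Finset.card_nsmul_le_sum _ _ _ fun i hi => pow_le_pow_left₀ hβ.le (hq i hi) t
  have hμ0 : 0 < μ := hν.trans_le hνμ
  have hEN : ∑ w, W w * N w = μ := by
    simp only [hN, Finset.mul_sum]
    rw [Finset.sum_comm]
    exact Finset.sum_congr rfl fun i _ => sum_prod_mul_prod p (u i) t
  set K := Real.exp (t * (η / β ^ 2)) with hK
  have hK1 : 1 ≤ K := Real.one_le_exp (by positivity)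
  -- Off the diagonal, `(q i * q l + η) ^ t` exceeds `(q i * q l) ^ t` by a factor at most `K`,
  -- because `q i * q l ≥ β ^ 2`. On the diagonal, `u i` is its own square.
  have hpair : ∀ i ∈ T, ∀ l ∈ T, (∑ a, p a * (u i a * u l a)) ^ t ≤
      (if i = l then q i ^ t else 0) + q i ^ t * q l ^ t * K := fun i hi l hl => by
    have hi0 := hβ.trans_le (hq i hi)
    have hl0 := hβ.trans_le (hq l hl)
    have hnn : 0 ≤ q i ^ t * q l ^ t * K := by positivity
    split_ifs with h
    · subst h
      have : ∀ a, u i a * u i a = u i a := fun a => by rcases hu i a with h | h <;> simp [h]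
      simp only [this]
      linarith
    · have hil : 0 < q i * q l := mul_pos hi0 hl0
      rw [zero_add, ← mul_pow]
      calc (∑ a, p a * (u i a * u l a)) ^ t ≤ (q i * q l + η) ^ t := by
            refine pow_le_pow_left₀ (Finset.sum_nonneg fun a _ => mul_nonneg (hp a) ?_)
              (hq2 i hi l hl h) t
            rcases hu i a with h | h <;> rcases hu l a with h' | h' <;> simp [h, h']
        _ = (q i * q l) ^ t * (1 + η / (q i * q l)) ^ t := by
            have aux : ∀ x : ℝ, 0 < x → x + η = x * (1 + η / x) := fun x hx => by field_simp
            rw [← mul_pow, ← aux _ hil]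
        _ ≤ (q i * q l) ^ t * K := by
            refine mul_le_mul_of_nonneg_left ?_ (by positivity)
            rw [hK, Real.exp_nat_mul]
            refine pow_le_pow_left₀ (by positivity) ?_ t
            have hb : η / (q i * q l) ≤ η / β ^ 2 := by
              refine div_le_div_of_nonneg_left hη (by positivity) ?_
              rw [sq]
              exact mul_le_mul (hq i hi) (hq l hl) hβ.le hi0.le
            linarith [Real.add_one_le_exp (η / β ^ 2)]
  have hEN2 : ∑ w, W w * N w ^ 2 ≤ μ + μ ^ 2 * K := by
    calc ∑ w, W w * N w ^ 2 = ∑ i ∈ T, ∑ l ∈ T, (∑ a, p a * (u i a * u l a)) ^ t := by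
          have hw : ∀ w, W w * N w ^ 2 =
              ∑ i ∈ T, ∑ l ∈ T, (∏ s, p (w s)) * ∏ s, u i (w s) * u l (w s) := fun w => by
            rw [sq, Finset.sum_mul_sum, Finset.mul_sum]
            refine Finset.sum_congr rfl fun i _ => ?_
            rw [Finset.mul_sum]
            refine Finset.sum_congr rfl fun l _ => ?_
            rw [Finset.prod_mul_distrib]
          rw [Finset.sum_congr rfl fun w _ => hw w, Finset.sum_comm]
          refine Finset.sum_congr rfl fun i _ => ?_
          rw [Finset.sum_comm]
          exact Finset.sum_congr rfl fun l _ => sum_prod_mul_prod p (fun a => u i a * u l a) t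
      _ ≤ ∑ i ∈ T, ∑ l ∈ T, ((if i = l then q i ^ t else 0) + q i ^ t * q l ^ t * K) :=
          Finset.sum_le_sum fun i hi => Finset.sum_le_sum fun l hl => hpair i hi l hl
      _ = μ + μ ^ 2 * K := by
          simp only [Finset.sum_add_distrib, Finset.sum_ite_eq]
          congr 1
          · exact Finset.sum_congr rfl fun i hi => if_pos hi
          · rw [sq, hμ, Finset.sum_mul_sum, Finset.sum_mul]
            simp only [Finset.sum_mul]
  have hsplit := Finset.sum_filter_add_sum_filter_not Finset.univ
    (fun w => ν / 2 ≤ N w) W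
  rw [hW1] at hsplit
  -- Where `N < ν / 2 ≤ μ / 2`, the distance from `N` to its mean `μ` is at least `μ / 2`.
  have hcheb : (∑ w with ¬ ν / 2 ≤ N w, W w) * (μ / 2) ^ 2 ≤ μ + μ ^ 2 * (K - 1) := by
    calc (∑ w with ¬ ν / 2 ≤ N w, W w) * (μ / 2) ^ 2
        ≤ ∑ w with ¬ ν / 2 ≤ N w, W w * (N w - μ) ^ 2 := by
          rw [Finset.sum_mul]
          refine Finset.sum_le_sum fun w hw => mul_le_mul_of_nonneg_left ?_ (hW0 w)
          have := not_le.1 (Finset.mem_filter.1 hw).2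
          nlinarith
      _ ≤ ∑ w, W w * (N w - μ) ^ 2 :=
          Finset.sum_le_sum_of_subset_of_nonneg (Finset.filter_subset _ _)
            fun w _ _ => mul_nonneg (hW0 w) (sq_nonneg _)
      _ = ∑ w, W w * N w ^ 2 - 2 * μ * ∑ w, W w * N w + μ ^ 2 * ∑ w, W w := by
          simp only [Finset.mul_sum, ← Finset.sum_sub_distrib, ← Finset.sum_add_distrib]
          exact Finset.sum_congr rfl fun w _ => by ring
      _ ≤ _ := by rw [hEN, hW1]; linarith
  have hfin : (∑ w with ¬ ν / 2 ≤ N w, W w) ≤ 4 / ν + 4 * (K - 1) := by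
    have h1 : (∑ w with ¬ ν / 2 ≤ N w, W w) ≤ (μ + μ ^ 2 * (K - 1)) / (μ / 2) ^ 2 :=
      (le_div_iff₀ (by positivity)).2 hcheb
    have h2 : (μ + μ ^ 2 * (K - 1)) / (μ / 2) ^ 2 = 4 / μ + 4 * (K - 1) := by
      field_simp
      ring
    have h3 : 4 / μ ≤ 4 / ν := div_le_div_of_nonneg_left (by norm_num) hν hνμ
    linarith
  linarith

end SecondMoment

/-! ### Untouched positions and the lower bound in total variation -/

namespace GenSymm

variable {m n : ℕ}

/-- The weight of the step with right hand `a.1`, left hand `a.2.1` and color `a.2.2`. -/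
noncomputable def stepWeight (a : Fin n × Fin n × ZMod m) : ℝ :=
  if a.2.1 ≤ a.1 then 1 / ((n : ℝ) * ((a.1 : ℕ) + 1 : ℝ) * (m : ℝ)) else 0

theorem stepWeight_nonneg (a : Fin n × Fin n × ZMod m) : 0 ≤ stepWeight a := by
  unfold stepWeight
  split_ifs <;> positivity

/-- The group element of a step. -/
def stepElem (a : Fin n × Fin n × ZMod m) : GenSymm m n := colorSwap a.2.1 a.1 a.2.2

/-- The indicator of the steps that do not touch the position `x`. -/
def untouched (x : Fin n) (a : Fin n × Fin n × ZMod m) : ℝ :=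
  if a.1 = x ∨ a.2.1 = x then 0 else 1

theorem untouched_eq (x : Fin n) (a : Fin n × Fin n × ZMod m) :
    untouched x a = 0 ∨ untouched x a = 1 := by
  unfold untouched
  split_ifs <;> simp

/-- Steps that avoid `x` fix it. Only an inequality holds, since a touched position may return to
its place. -/
theorem prod_untouched_le {t : ℕ} (x : Fin n) (w : Fin t → Fin n × Fin n × ZMod m) :
    ∏ s, untouched x (w s) ≤
      if (List.ofFn fun s => stepElem (w s)).prod.perm x = x then 1 else 0 := by
  by_cases h : ∀ s, untouched x (w s) = 1
  · let H : Submonoid (GenSymm m n) :=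
      { carrier := {g | g.perm x = x}
        one_mem' := rfl
        mul_mem' := fun {a b} ha hb => by
          change (a * b).perm x = x
          change a.perm x = x at ha
          change b.perm x = x at hb
          rw [mul_perm, Equiv.trans_apply, ha, hb] }
    have hmem : (List.ofFn fun s => stepElem (w s)).prod ∈ H := by
      refine H.list_prod_mem fun g hg => ?_
      obtain ⟨s, rfl⟩ := (List.mem_ofFn' _ _).1 hg
      have hs := h s
      simp only [untouched] at hs
      split_ifs at hs with h'
      · simp at hs
      · rw [not_or] at h'
        exact Equiv.swap_apply_of_ne_of_ne (Ne.symm h'.2) (Ne.symm h'.1)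
    rw [if_pos (show _ = x from hmem)]
    simp [h]
  · push Not at h
    obtain ⟨s, hs⟩ := h
    rw [Finset.prod_eq_zero (Finset.mem_univ s) ((untouched_eq x _).resolve_right hs)]
    split_ifs <;> norm_num

variable [NeZero m]


/-- Right multiplication by a transposition shows that the image of `i` is equidistributed. -/
theorem sum_uniformDist_fixed (i : Fin n) :
    ∑ g : GenSymm m n, (if g.perm i = i then uniformDist (GenSymm m n) g else 0) = 1 / n := by
  have hn : (n : ℝ) ≠ 0 := Nat.cast_ne_zero.2 (by have := i.2; omega)
  have hconst : ∀ j, ∑ g : GenSymm m n, (if g.perm i = j then uniformDist (GenSymm m n) g else 0) =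
      ∑ g : GenSymm m n, (if g.perm i = i then uniformDist (GenSymm m n) g else 0) := fun j => by
    rw [← Equiv.sum_comp (Equiv.mulRight (ofPerm m (Equiv.swap i j)))]
    refine Finset.sum_congr rfl fun g _ => ?_
    have : Equiv.swap i j (g.perm i) = j ↔ g.perm i = i := by
      have := (Equiv.swap i j).injective.eq_iff (a := g.perm i) (b := i)
      rwa [Equiv.swap_apply_left] at this
    simp [ofPerm, this, uniformDist]
  have hsum : ∑ j, ∑ g : GenSymm m n, (if g.perm i = j then uniformDist (GenSymm m n) g else 0) =
      1 := by
    rw [Finset.sum_comm]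
    simp [uniformDist]
  simp only [hconst, Finset.sum_const, Finset.card_univ, Fintype.card_fin, nsmul_eq_mul] at hsum
  rw [eq_div_iff hn, mul_comm]
  exact hsum

theorem sum_stepWeight_mul (F : Fin n → Fin n → ℝ) :
    ∑ a : Fin n × Fin n × ZMod m, stepWeight a * F a.1 a.2.1 =
      ∑ j : Fin n, ∑ i ∈ Finset.Iic j, 1 / ((n : ℝ) * ((j : ℕ) + 1 : ℝ)) * F j i := by
  have hm : (m : ℝ) ≠ 0 := Nat.cast_ne_zero.2 (NeZero.ne m)
  simp only [Fintype.sum_prod_type, stepWeight]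
  refine Finset.sum_congr rfl fun j _ => ?_
  have : Finset.Iic j = Finset.univ.filter (· ≤ j) := by ext; simp
  rw [this, Finset.sum_filter]
  refine Finset.sum_congr rfl fun i _ => ?_
  split_ifs
  · simp only [Finset.sum_const, Finset.card_univ, ZMod.card, nsmul_eq_mul]
    have : ((j : ℕ) : ℝ) + 1 ≠ 0 := by positivity
    field_simp
  · simp

theorem sum_stepWeight (hn : 1 ≤ n) : ∑ a : Fin n × Fin n × ZMod m, stepWeight a = 1 := by
  have hn0 : (n : ℝ) ≠ 0 := by positivity
  have := sum_stepWeight_mul (m := m) (n := n) fun _ _ => 1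
  simp only [mul_one] at this
  rw [this]
  have h : ∀ j : Fin n, ∑ i ∈ Finset.Iic j, 1 / ((n : ℝ) * ((j : ℕ) + 1 : ℝ)) = 1 / n := fun j => by
    rw [Finset.sum_const, Fin.card_Iic, nsmul_eq_mul]
    push_cast
    field_simp
  rw [Finset.sum_congr rfl fun j _ => h j]
  simp [hn0]

theorem ostShuffle_eq (g : GenSymm m n) : ostShuffle m n g =
    ∑ a : Fin n × Fin n × ZMod m, if g = stepElem a then stepWeight a else 0 := by
  simp only [Fintype.sum_prod_type, stepWeight, ostShuffle, stepElem]
  refine Finset.sum_congr rfl fun j _ => ?_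
  have : Finset.Iic j = Finset.univ.filter (· ≤ j) := by ext; simp
  rw [this, Finset.sum_filter]
  refine Finset.sum_congr rfl fun i _ => ?_
  split_ifs with h
  · rfl
  · simp

theorem ostShuffle_nonneg (g : GenSymm m n) : 0 ≤ ostShuffle m n g := by
  rw [ostShuffle_eq]
  refine Finset.sum_nonneg fun a _ => ?_
  split_ifs
  exacts [stepWeight_nonneg a, le_rfl]

theorem sum_ostShuffle (hn : 1 ≤ n) : ∑ g, ostShuffle m n g = 1 := by
  simp only [ostShuffle_eq]
  rw [Finset.sum_comm]
  simp [sum_stepWeight hn]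

theorem convPow_ostShuffle (t : ℕ) (g : GenSymm m n) : convPow (ostShuffle m n) t g =
    ∑ w : Fin t → Fin n × Fin n × ZMod m,
      if (List.ofFn fun s => stepElem (w s)).prod = g then ∏ s, stepWeight (w s) else 0 := by
  have h : groupAlgebraSum (ostShuffle m n) = ∑ a, stepWeight a • point (stepElem a) := by
    simp only [groupAlgebraSum, ostShuffle_eq, Finset.sum_smul]
    rw [Finset.sum_comm]
    simp [ite_smul]
  rw [convPow_eq_coeff, h, sum_pow_eq_sum_prod_ofFn, MonoidAlgebra.coeff_sum,
    Finsupp.finsetSum_apply]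
  refine Finset.sum_congr rfl fun w _ => ?_
  rw [prod_ofFn_smul]
  have : (List.ofFn fun s => point (stepElem (w s))).prod =
      point (List.ofFn fun s => stepElem (w s)).prod := by
    rw [map_list_prod, List.map_ofFn]
    rfl
  rw [this, MonoidAlgebra.coeff_smul_apply, MonoidAlgebra.of_apply, MonoidAlgebra.coeff_single,
    Finsupp.single_apply, smul_eq_mul, mul_ite, mul_one, mul_zero]

/-- The right hand is `x` with probability `1/n`; the left hand is `x` with probability at most `(n
- c) / (n c)`, as this needs a right hand `j ≥ x`. The sum is `1/c`; counting the step with both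
hands at `x` twice does no harm. -/
theorem le_sum_untouched {c : ℕ} (hc : 1 ≤ c) (x : Fin n) (hx : c ≤ (x : ℕ)) :
    1 - 1 / (c : ℝ) ≤ ∑ a : Fin n × Fin n × ZMod m, stepWeight a * untouched x a := by
  have hn : 1 ≤ n := by have := x.2; omega
  have hn0 : (0 : ℝ) < n := by exact_mod_cast hn
  have hc0 : (0 : ℝ) < c := by exact_mod_cast hc
  have hle : ∀ a : Fin n × Fin n × ZMod m, stepWeight a - stepWeight a *
      ((if a.1 = x then 1 else 0) + (if a.2.1 = x then 1 else 0)) ≤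
      stepWeight a * untouched x a := fun a => by
    have := stepWeight_nonneg a
    rw [← mul_one_sub]
    refine mul_le_mul_of_nonneg_left ?_ this
    by_cases h1 : a.1 = x <;> by_cases h2 : a.2.1 = x <;> simp [untouched, h1, h2]
  refine le_trans ?_ (Finset.sum_le_sum fun a _ => hle a)
  rw [Finset.sum_sub_distrib, sum_stepWeight hn,
    sum_stepWeight_mul fun j i => (if j = x then 1 else 0) + (if i = x then 1 else 0)]
  refine sub_le_sub_left ?_ 1
  simp only [mul_add (_ / _), Finset.sum_add_distrib]
  have h1 : ∑ j : Fin n, ∑ i ∈ Finset.Iic j,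
      1 / ((n : ℝ) * ((j : ℕ) + 1 : ℝ)) * (if j = x then 1 else 0) = 1 / n := by
    rw [Finset.sum_eq_single x (fun j _ h => by simp [h]) (by simp)]
    rw [Finset.sum_const, Fin.card_Iic, nsmul_eq_mul]
    push_cast
    simp only [if_true]
    field_simp
  have h2 : ∑ j : Fin n, ∑ i ∈ Finset.Iic j,
      1 / ((n : ℝ) * ((j : ℕ) + 1 : ℝ)) * (if i = x then 1 else 0) ≤
      ∑ j ∈ Finset.Ici x, 1 / ((n : ℝ) * c) := by
    have : Finset.Ici x = Finset.univ.filter (x ≤ ·) := by ext; simp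
    rw [this, Finset.sum_filter]
    refine Finset.sum_le_sum fun j _ => ?_
    simp only [mul_ite, mul_one, mul_zero, Finset.sum_ite_eq', Finset.mem_Iic]
    split_ifs with h
    · refine one_div_le_one_div_of_le (by positivity) ?_
      refine mul_le_mul_of_nonneg_left ?_ hn0.le
      have : c ≤ (j : ℕ) + 1 := by have : (x : ℕ) ≤ j := h; omega
      exact_mod_cast this
    · exact le_rfl
  rw [Finset.sum_const, Fin.card_Ici, nsmul_eq_mul] at h2
  have h3 : ((n - (x : ℕ) : ℕ) : ℝ) ≤ n - c := by
    rw [Nat.cast_sub x.2.le]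
    have : (c : ℝ) ≤ (x : ℕ) := by exact_mod_cast hx
    linarith
  have h4 := mul_le_mul_of_nonneg_right h3 (show 0 ≤ 1 / ((n : ℝ) * c) by positivity)
  have h5 : 1 / (n : ℝ) + (n - c) * (1 / ((n : ℝ) * c)) = 1 / c := by
    field_simp
    ring
  linarith

/-- Inclusion–exclusion: a step touches both positions only with its hands at `x` and `y`, in one of
two orders of probability at most `1 / (n c)` each. The rest is `p + q - 1 ≤ p q` for `p, q ≤ 1`. -/
theorem sum_untouched_mul_le {c : ℕ} (hc : 1 ≤ c) {x y : Fin n} (hx : c ≤ (x : ℕ))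
    (hy : c ≤ (y : ℕ)) (hxy : x ≠ y) :
    ∑ a : Fin n × Fin n × ZMod m, stepWeight a * (untouched x a * untouched y a) ≤
      (∑ a : Fin n × Fin n × ZMod m, stepWeight a * untouched x a) *
        (∑ a : Fin n × Fin n × ZMod m, stepWeight a * untouched y a) + 2 / (n * c) := by
  have hn : 1 ≤ n := by have := x.2; omega
  have hn0 : (0 : ℝ) < n := by exact_mod_cast hn
  have hc0 : (0 : ℝ) < c := by exact_mod_cast hc
  have hone : ∀ x : Fin n,
      ∑ a : Fin n × Fin n × ZMod m, stepWeight a * untouched x a ≤ 1 := fun x => by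
    rw [← sum_stepWeight (m := m) hn]
    refine Finset.sum_le_sum fun a _ => mul_le_of_le_one_right (stepWeight_nonneg a) ?_
    rcases untouched_eq x a with h | h <;> simp [h]
  have hle : ∀ a : Fin n × Fin n × ZMod m, stepWeight a * (untouched x a * untouched y a) ≤
      stepWeight a * untouched x a + stepWeight a * untouched y a - stepWeight a +
        (stepWeight a * ((if a.1 = x then if a.2.1 = y then 1 else 0 else 0) +
          (if a.1 = y then if a.2.1 = x then 1 else 0 else 0))) := fun a => by
    rw [← mul_add, ← mul_sub_one, ← mul_add]
    refine mul_le_mul_of_nonneg_left ?_ (stepWeight_nonneg a)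
    by_cases h1 : a.1 = x
    · have h1' : a.1 ≠ y := fun h => hxy (h1.symm.trans h)
      by_cases h2 : a.2.1 = y
      · have h2' : a.2.1 ≠ x := fun h => hxy (h.symm.trans h2)
        simp [untouched, h1, h2, hxy]
      · by_cases h3 : a.2.1 = x <;> simp [untouched, h1, h2, h3, hxy]
    · by_cases h2 : a.1 = y <;> by_cases h3 : a.2.1 = x <;> by_cases h4 : a.2.1 = y <;>
        simp [untouched, h1, h2, h3, h4, hxy, hxy.symm]
  have hb : ∀ x y : Fin n, c ≤ (x : ℕ) → ∑ j : Fin n, ∑ i ∈ Finset.Iic j,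
      1 / ((n : ℝ) * ((j : ℕ) + 1 : ℝ)) * (if j = x then if i = y then 1 else 0 else 0) ≤
        1 / (n * c) := fun x y hx => by
    rw [Finset.sum_eq_single x (fun j _ h => by simp [h]) (by simp)]
    simp only [if_true, mul_ite, mul_one, mul_zero, Finset.sum_ite_eq', Finset.mem_Iic]
    split_ifs
    · refine one_div_le_one_div_of_le (by positivity) (mul_le_mul_of_nonneg_left ?_ hn0.le)
      have : c ≤ (x : ℕ) + 1 := by omega
      exact_mod_cast this
    · positivity
  have h := Finset.sum_le_sum fun a (_ : a ∈ Finset.univ) => hle a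
  rw [Finset.sum_add_distrib, Finset.sum_sub_distrib, Finset.sum_add_distrib, sum_stepWeight hn,
    sum_stepWeight_mul fun j i => (if j = x then if i = y then 1 else 0 else 0) +
      (if j = y then if i = x then 1 else 0 else 0)] at h
  simp only [mul_add (_ / _), Finset.sum_add_distrib] at h
  have h1 := hb x y hx
  have h2 := hb y x hy
  have h3 := mul_nonneg (sub_nonneg.2 (hone x)) (sub_nonneg.2 (hone y))
  have h4 : (2 : ℝ) / (n * c) = 1 / (n * c) + 1 / (n * c) := by ring
  rw [h4]
  linarith

/-- A lower bound for the distance in total variation, from the number of positions `≥ c` that have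
not been touched. -/
theorem le_dTV_ostShuffle {c : ℕ} (hc : 2 ≤ c) (hcn : c < n) (t : ℕ) :
    1 - (6 / ((n - c) * (1 - 1 / (c : ℝ)) ^ t) + 4 * (Real.exp (8 * t / (n * c)) - 1)) ≤
      dTV (ostShuffle m n) t := by
  have hn : 1 ≤ n := by omega
  have hn0 : (0 : ℝ) < n := by exact_mod_cast hn
  have hc2 : (2 : ℝ) ≤ c := by exact_mod_cast hc
  have hc0 : (0 : ℝ) < c := by linarith
  have hcn' : (c : ℝ) < n := by exact_mod_cast hcn
  have hβ : 1 / 2 ≤ 1 - 1 / (c : ℝ) := by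
    have := one_div_le_one_div_of_le (by norm_num : (0 : ℝ) < 2) hc2
    linarith
  have hβ0 : 0 < 1 - 1 / (c : ℝ) := by linarith
  set T : Finset (Fin n) := Finset.univ.filter fun x => c ≤ (x : ℕ) with hT
  have hcard : (T.card : ℝ) = n - c := by
    have : T = Finset.Ici ⟨c, hcn⟩ := by ext x; simp [hT, Fin.le_def]
    rw [this, Fin.card_Ici, Nat.cast_sub hcn.le]
  set ν := (n - c) * (1 - 1 / (c : ℝ)) ^ t with hν
  have hν0 : 0 < ν := mul_pos (by linarith) (by positivity)
  have hmem : ∀ x ∈ T, c ≤ (x : ℕ) := fun x hx => (Finset.mem_filter.1 hx).2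
  have hwords := one_sub_le_sum_words (stepWeight_nonneg (m := m) (n := n)) (sum_stepWeight hn) T
    untouched untouched_eq hβ0 (show (0 : ℝ) ≤ 2 / (n * c) by positivity)
    (fun x hx => le_sum_untouched (by omega) x (hmem x hx))
    (fun x hx y hy hxy => sum_untouched_mul_le (by omega) (hmem x hx) (hmem y hy) hxy)
    t hν0 (by rw [hcard])
  -- The constant is `8 = 2 · 4`, from `1 - 1/c ≥ 1/2`.
  have hexp : Real.exp (t * (2 / (n * c) / (1 - 1 / (c : ℝ)) ^ 2)) ≤
      Real.exp (8 * t / (n * c)) := by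
    refine Real.exp_le_exp.2 ?_
    have : 2 / (n * c) / (1 - 1 / (c : ℝ)) ^ 2 ≤ 8 / (n * c) := by
      rw [div_le_iff₀ (by positivity)]
      have h : (1 / 2 : ℝ) ^ 2 ≤ (1 - 1 / (c : ℝ)) ^ 2 := pow_le_pow_left₀ (by norm_num) hβ 2
      have := mul_le_mul_of_nonneg_left h (show (0 : ℝ) ≤ 8 / (n * c) by positivity)
      calc (2 : ℝ) / (n * c) = 8 / (n * c) * (1 / 2) ^ 2 := by ring
        _ ≤ _ := this
    calc (t : ℝ) * (2 / (n * c) / (1 - 1 / (c : ℝ)) ^ 2) ≤ t * (8 / (n * c)) :=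
          mul_le_mul_of_nonneg_left this (by positivity)
      _ = _ := by ring
  let f : GenSymm m n → ℝ := fun g => ∑ x ∈ T, if g.perm x = x then 1 else 0
  have hf0 : ∀ g, 0 ≤ f g := fun g => Finset.sum_nonneg fun x _ => by split_ifs <;> norm_num
  let A : Finset (GenSymm m n) := Finset.univ.filter fun g => ν / 2 ≤ f g
  have hP : ∑ w : Fin t → Fin n × Fin n × ZMod m with
      ν / 2 ≤ ∑ i ∈ T, ∏ s, untouched i (w s), ∏ s, stepWeight (w s) ≤
      ∑ g ∈ A, convPow (ostShuffle m n) t g := by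
    simp only [convPow_ostShuffle]
    rw [Finset.sum_comm, Finset.sum_filter]
    refine Finset.sum_le_sum fun w _ => ?_
    rw [Finset.sum_ite_eq]
    have hw : 0 ≤ ∏ s, stepWeight (w s) := Finset.prod_nonneg fun _ _ => stepWeight_nonneg _
    split_ifs with h1 h2 h2
    · exact le_rfl
    · refine absurd ?_ h2
      rw [Finset.mem_filter]
      exact ⟨Finset.mem_univ _,
        h1.trans (Finset.sum_le_sum fun x _ => prod_untouched_le x w)⟩
    · exact hw
    · exact le_rfl
  -- Markov's inequality: the mean number of fixed points in `T` is `(n - c) / n ≤ 1`.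
  have hU : ∑ g ∈ A, uniformDist (GenSymm m n) g ≤ 2 / ν := by
    have h1 : (∑ g ∈ A, uniformDist (GenSymm m n) g) * (ν / 2) ≤ 1 := by
      calc (∑ g ∈ A, uniformDist (GenSymm m n) g) * (ν / 2)
          ≤ ∑ g ∈ A, uniformDist (GenSymm m n) g * f g := by
            rw [Finset.sum_mul]
            exact Finset.sum_le_sum fun g hg =>
              mul_le_mul_of_nonneg_left (Finset.mem_filter.1 hg).2 (uniformDist_pos g).le
        _ ≤ ∑ g, uniformDist (GenSymm m n) g * f g :=
            Finset.sum_le_sum_of_subset_of_nonneg (Finset.subset_univ _)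
              fun g _ _ => mul_nonneg (uniformDist_pos g).le (hf0 g)
        _ = ∑ x ∈ T, 1 / (n : ℝ) := by
            simp only [f, Finset.mul_sum, mul_ite, mul_one, mul_zero]
            rw [Finset.sum_comm]
            exact Finset.sum_congr rfl fun x _ => sum_uniformDist_fixed x
        _ ≤ 1 := by
            rw [Finset.sum_const, nsmul_eq_mul, hcard, mul_one_div, div_le_one hn0]
            linarith
    rw [le_div_iff₀ hν0]
    linarith
  have htv : ∑ g ∈ A, convPow (ostShuffle m n) t g - ∑ g ∈ A, uniformDist (GenSymm m n) g ≤
      dTV (ostShuffle m n) t :=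
    sum_sub_sum_le_tvDist (by rw [sum_convPow (sum_ostShuffle hn), sum_uniformDist]) A
  have : 6 / ν = 4 / ν + 2 / ν := by ring
  linarith

end GenSymm

/-! ### Estimates before and after the cutoff -/

-- Here `(1 - 1/n)^t ≤ exp (-t/n)`, and rounding down costs at most `1/n ≤ 1` in `t/n`, hence the
-- factor `e`.
open GenSymm in
theorem dSep_ostShuffle_le_div_log (m : ℕ) [NeZero m] {n : ℕ} (hn : 1 ≤ n)
    (hlog : 1 ≤ Real.log n) :
    dSep (ostShuffle m n) ⌊(n : ℝ) * Real.log n + 1 * (n * Real.log (Real.log n))⌋₊ ≤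
      Real.exp 1 / Real.log n := by
  set Y := Real.log n with hY
  set t := ⌊(n : ℝ) * Y + 1 * (n * Real.log Y)⌋₊ with ht
  have hn0 : (0 : ℝ) < n := by exact_mod_cast hn
  have hn1 : (1 : ℝ) ≤ n := by exact_mod_cast hn
  have hY0 : 0 < Y := by linarith
  have ht1 : (n : ℝ) * Y + 1 * (n * Real.log Y) < t + 1 := Nat.lt_floor_add_one _
  refine (dSep_ostShuffle_le m hn t).trans ?_
  have h1 : (1 - 1 / (n : ℝ)) ^ t ≤ Real.exp (-(t / n)) := by
    have := Real.one_sub_le_exp_neg (1 / (n : ℝ))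
    have h0 : 0 ≤ 1 - 1 / (n : ℝ) := by
      rw [sub_nonneg, div_le_one hn0]
      exact hn1
    calc _ ≤ Real.exp (-(1 / (n : ℝ))) ^ t := pow_le_pow_left₀ h0 this t
      _ = _ := by
        rw [← Real.exp_nat_mul]
        congr 1
        ring
  have h2 : -((t : ℝ) / n) ≤ -Y - Real.log Y + 1 := by
    have : Y + Real.log Y - 1 ≤ (t : ℝ) / n := by
      rw [le_div_iff₀ hn0]
      nlinarith
    linarith
  calc n * (1 - 1 / (n : ℝ)) ^ t ≤ n * Real.exp (-Y - Real.log Y + 1) :=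
        mul_le_mul_of_nonneg_left (h1.trans (Real.exp_le_exp.2 h2)) hn0.le
    _ = Real.exp 1 / Y := by
        rw [Real.exp_add, Real.exp_sub, Real.exp_neg, Real.exp_log hY0, hY, Real.exp_log hn0]
        field_simp

-- Take `c = n - ⌊n / log n⌋`. One of the two factors `log n` gained from `-2 n log log n` pays for
-- keeping only the last `n / log n` positions; the other makes the mean number of untouched
-- positions grow.
open GenSymm in
theorem le_dTV_ostShuffle_log (m : ℕ) [NeZero m] {n : ℕ}
    (hlog : 3 ≤ Real.log n) (hlogn : 4 * Real.log n ≤ n)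
    (hloglog : 2 * Real.log (Real.log n) ≤ Real.log n) :
    1 - (12 * Real.exp 3 / Real.log n + 4 * (Real.exp (16 * (Real.log n / n)) - 1)) ≤
      dTV (ostShuffle m n) ⌊(n : ℝ) * Real.log n + (-2) * (n * Real.log (Real.log n))⌋₊ := by
  set Y := Real.log n with hY
  have hY0 : 0 < Y := by linarith
  have hn0 : (0 : ℝ) < n := by linarith
  have hlY : 0 ≤ Real.log Y := Real.log_nonneg (by linarith)
  set Z := Y - 2 * Real.log Y with hZ
  have hZ0 : 0 ≤ Z := by linarith
  have hZY : Z ≤ Y := by linarith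
  have harg : (n : ℝ) * Y + (-2) * (n * Real.log Y) = n * Z := by rw [hZ]; ring
  rw [harg]
  set t := ⌊(n : ℝ) * Z⌋₊ with ht
  have htZ : (t : ℝ) ≤ n * Z := Nat.floor_le (by positivity)
  set r := ⌊(n : ℝ) / Y⌋₊ with hr
  have hrle : (r : ℝ) ≤ n / Y := Nat.floor_le (by positivity)
  have hnY : (n : ℝ) / Y ≤ n / 3 := div_le_div_of_nonneg_left hn0.le (by norm_num) hlog
  have hnY4 : 4 ≤ (n : ℝ) / Y := (le_div_iff₀ hY0).2 hlogn
  have hrge : (n : ℝ) / (2 * Y) ≤ r := by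
    have h1 : (n : ℝ) / Y < r + 1 := Nat.lt_floor_add_one _
    have h2 : (n : ℝ) / (2 * Y) = n / Y / 2 := by field_simp
    linarith
  have hrn : r ≤ n := by
    have : (r : ℝ) ≤ n := by linarith
    exact_mod_cast this
  obtain ⟨c, hcr⟩ : ∃ c, c + r = n := ⟨n - r, Nat.sub_add_cancel hrn⟩
  have hcast : (c : ℝ) = n - r := by rw [← hcr]; push_cast; ring
  have hchalf : (n : ℝ) / 2 ≤ c := by linarith
  have hc2 : (2 : ℝ) ≤ c := by linarith
  have hcn : (c : ℝ) < n := by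
    have : 0 < (n : ℝ) / (2 * Y) := by positivity
    linarith
  have hkey := le_dTV_ostShuffle (m := m) (by exact_mod_cast hc2 : 2 ≤ c)
    (by exact_mod_cast hcn : c < n) t
  have hc1 : (0 : ℝ) < c - 1 := by linarith
  -- Replacing `n` by `c - 1` costs at most `(Y + 3) * (n / Y + 1) = n + Y + 3 * (n / Y) + 3 ≤ 3 *
  -- n`, which is where the `3` comes from.
  have htc : (t : ℝ) / (c - 1) ≤ Z + 3 := by
    rw [div_le_iff₀ hc1]
    have h1 : (n : ℝ) - n / Y - 1 ≤ c - 1 := by linarith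
    have h2 : (Z + 3) * (n / Y + 1) ≤ (Y + 3) * (n / Y + 1) :=
      mul_le_mul_of_nonneg_right (by linarith) (by positivity)
    have h3 : (Y + 3) * (n / Y + 1) = n + Y + 3 * (n / Y) + 3 := by
      field_simp
      ring
    have h4 := mul_le_mul_of_nonneg_left h1 (show 0 ≤ Z + 3 by linarith)
    nlinarith
  have hpow : Real.exp (-(Z + 3)) ≤ (1 - 1 / (c : ℝ)) ^ t := by
    have hc0 : (0 : ℝ) < c := by linarith
    have hpos : (0 : ℝ) < 1 - 1 / c := by
      rw [sub_pos, div_lt_one hc0]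
      linarith
    have hl : -(1 / ((c : ℝ) - 1)) ≤ Real.log (1 - 1 / c) := by
      refine le_trans (le_of_eq ?_) (Real.one_sub_inv_le_log_of_pos hpos)
      rw [one_sub_div hc0.ne', inv_div]
      field_simp
      ring
    calc Real.exp (-(Z + 3)) ≤ Real.exp (t * Real.log (1 - 1 / (c : ℝ))) := by
          refine Real.exp_le_exp.2 ?_
          have := mul_le_mul_of_nonneg_left hl (Nat.cast_nonneg (α := ℝ) t)
          have h' : (t : ℝ) * -(1 / ((c : ℝ) - 1)) = -(t / (c - 1)) := by ring
          linarith
      _ = _ := by rw [Real.exp_nat_mul, Real.exp_log hpos]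
  have hμ : Y / (2 * Real.exp 3) ≤ (n - c) * (1 - 1 / (c : ℝ)) ^ t := by
    have hexp : Real.exp (-(Z + 3)) = Y ^ 2 / (n * Real.exp 3) := by
      rw [hZ, show -(Y - 2 * Real.log Y + 3) = Real.log Y + Real.log Y - Y - 3 by ring,
        Real.exp_sub, Real.exp_sub, Real.exp_add, Real.exp_log hY0, hY, Real.exp_log hn0]
      field_simp
    calc Y / (2 * Real.exp 3) = n / (2 * Y) * (Y ^ 2 / (n * Real.exp 3)) := by field_simp
      _ ≤ (n - c) * (1 - 1 / (c : ℝ)) ^ t := by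
          rw [← hexp]
          exact mul_le_mul (by linarith) hpow (Real.exp_pos _).le (by linarith)
  have h6 : 6 / ((n - c) * (1 - 1 / (c : ℝ)) ^ t) ≤ 12 * Real.exp 3 / Y := by
    calc 6 / ((n - c) * (1 - 1 / (c : ℝ)) ^ t) ≤ 6 / (Y / (2 * Real.exp 3)) :=
          div_le_div_of_nonneg_left (by norm_num) (by positivity) hμ
      _ = _ := by field_simp; ring
  -- Uses `t ≤ n * Y` and `c ≥ n / 2`.
  have h8 : Real.exp (8 * t / (n * c)) ≤ Real.exp (16 * (Y / n)) := by
    refine Real.exp_le_exp.2 ?_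
    have hc0 : (0 : ℝ) < c := by linarith
    rw [div_le_iff₀ (by positivity)]
    have h1 : (t : ℝ) ≤ n * Y := htZ.trans (mul_le_mul_of_nonneg_left hZY hn0.le)
    have h2 : 16 * (Y / n) * (n * c) = 16 * Y * c := by field_simp
    rw [h2]
    nlinarith
  linarith

/-! ### Limits in `n` and the cutoff -/

theorem tendsto_log_nat : Tendsto (fun n : ℕ => Real.log n) atTop atTop :=
  Real.tendsto_log_atTop.comp tendsto_natCast_atTop_atTop

theorem tendsto_log_div_self : Tendsto (fun x : ℝ => Real.log x / x) atTop (𝓝 0) :=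
  Real.isLittleO_log_id_atTop.tendsto_div_nhds_zero

theorem theorem5p1 (m : ℕ) [NeZero m] :
    HasCutoffAt (fun n t => dTV (ostShuffle m n) t)
      (fun n => (n : ℝ) * Real.log n) (fun n => (n : ℝ) * Real.log (Real.log n)) ∧
    HasCutoffAt (fun n t => dSep (ostShuffle m n) t)
      (fun n => (n : ℝ) * Real.log n) (fun n => (n : ℝ) * Real.log (Real.log n)) := by
  have hlogdiv : Tendsto (fun n : ℕ => Real.log n / n) atTop (𝓝 0) :=
    tendsto_log_div_self.comp tendsto_natCast_atTop_atTop
  have hloglogdiv : Tendsto (fun n : ℕ => Real.log (Real.log n) / Real.log n) atTop (𝓝 0) :=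
    tendsto_log_div_self.comp tendsto_log_nat
  have hn : ∀ᶠ n : ℕ in atTop, 1 ≤ n := eventually_ge_atTop 1
  have hlog3 : ∀ᶠ n : ℕ in atTop, 3 ≤ Real.log n := tendsto_log_nat.eventually_ge_atTop 3
  have hlogn : ∀ᶠ n : ℕ in atTop, 4 * Real.log n ≤ n := by
    filter_upwards [hlogdiv.eventually_le_const (show (0 : ℝ) < 1 / 4 by norm_num), hn]
      with n h1 h2
    have : (0 : ℝ) < n := by exact_mod_cast h2
    rw [div_le_iff₀ this] at h1
    linarith
  have hloglog : ∀ᶠ n : ℕ in atTop, 2 * Real.log (Real.log n) ≤ Real.log n := by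
    filter_upwards [hloglogdiv.eventually_le_const (show (0 : ℝ) < 1 / 2 by norm_num), hlog3]
      with n h1 h2
    rw [div_le_iff₀ (by linarith)] at h1
    linarith
  have hτ : ∀ᶠ n : ℕ in atTop, 0 < (n : ℝ) * Real.log n := by
    filter_upwards [hn, hlog3] with n h1 h2
    have : (0 : ℝ) < n := by exact_mod_cast h1
    exact mul_pos this (by linarith)
  have hw : ∀ᶠ n : ℕ in atTop, 0 < (n : ℝ) * Real.log (Real.log n) := by
    filter_upwards [hn, hlog3] with n h1 h2
    have : (0 : ℝ) < n := by exact_mod_cast h1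
    exact mul_pos this (Real.log_pos (by linarith))
  have hwτ : Tendsto (fun n : ℕ => (n : ℝ) * Real.log (Real.log n) / (n * Real.log n))
      atTop (𝓝 0) := by
    refine hloglogdiv.congr' ?_
    filter_upwards [hn] with n h1
    have : (n : ℝ) ≠ 0 := by positivity
    rw [mul_div_mul_left _ _ this]
  have hSep : Tendsto (fun n : ℕ => Real.exp 1 / Real.log n) atTop (𝓝 0) :=
    tendsto_log_nat.const_div_atTop _
  have hTV : Tendsto (fun n : ℕ => 1 - (12 * Real.exp 3 / Real.log n +
      4 * (Real.exp (16 * (Real.log n / n)) - 1))) atTop (𝓝 1) := by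
    have h1 := tendsto_log_nat.const_div_atTop (12 * Real.exp 3)
    have h2 := (Real.continuous_exp.tendsto _).comp (hlogdiv.const_mul 16)
    have h3 := (h1.add ((h2.sub_const 1).const_mul 4)).const_sub 1
    simpa using h3
  -- By this comparison, the lower bound for total variation and the upper bound for separation
  -- apply to both distances.
  have hTVSep : ∀ᶠ n in atTop, ∀ t, dTV (ostShuffle m n) t ≤ dSep (ostShuffle m n) t := by
    filter_upwards [hn] with n h1 t using dTV_le_dSep (GenSymm.sum_ostShuffle h1) t
  have hSep1 : ∀ᶠ n in atTop, ∀ t, dSep (ostShuffle m n) t ≤ 1 :=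
    Eventually.of_forall fun n t => dSep_le_one GenSymm.ostShuffle_nonneg t
  have hSep0 : ∀ᶠ n in atTop, ∀ t, 0 ≤ dSep (ostShuffle m n) t := by
    filter_upwards [hn] with n h1 t using dSep_nonneg (GenSymm.sum_ostShuffle h1) t
  have hTV1 : ∀ᶠ n in atTop, ∀ t, dTV (ostShuffle m n) t ≤ 1 := by
    filter_upwards [hTVSep, hSep1] with n h1 h2 t using (h1 t).trans (h2 t)
  have hTV0 : ∀ᶠ n in atTop, ∀ t, 0 ≤ dTV (ostShuffle m n) t :=
    Eventually.of_forall fun n t => dTV_nonneg _ t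
  have hlow : ∀ᶠ n : ℕ in atTop, 1 - (12 * Real.exp 3 / Real.log n +
      4 * (Real.exp (16 * (Real.log n / n)) - 1)) ≤
      dTV (ostShuffle m n) ⌊(n : ℝ) * Real.log n + (-2) * (n * Real.log (Real.log n))⌋₊ := by
    filter_upwards [hlog3, hlogn, hloglog] with n h1 h2 h3 using le_dTV_ostShuffle_log m h1 h2 h3
  have hupp : ∀ᶠ n : ℕ in atTop,
      dSep (ostShuffle m n) ⌊(n : ℝ) * Real.log n + 1 * (n * Real.log (Real.log n))⌋₊ ≤
        Real.exp 1 / Real.log n := by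
    filter_upwards [hn, hlog3] with n h1 h2 using dSep_ostShuffle_le_div_log m h1 (by linarith)
  refine ⟨.of_antitone ?_ hTV0 hTV1 hτ hw hwτ ?_ ?_, .of_antitone ?_ hSep0 hSep1 hτ hw hwτ ?_ ?_⟩
  · filter_upwards [hn] with n h1 using
      antitone_dTV GenSymm.ostShuffle_nonneg (GenSymm.sum_ostShuffle h1)
  · refine tendsto_of_tendsto_of_tendsto_of_le_of_le' hTV tendsto_const_nhds hlow ?_
    filter_upwards [hTV1] with n h using h _
  · refine tendsto_of_tendsto_of_tendsto_of_le_of_le' tendsto_const_nhds hSep ?_ ?_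
    · filter_upwards [hTV0] with n h using h _
    · filter_upwards [hTVSep, hupp] with n h1 h2 using (h1 _).trans h2
  · filter_upwards [hn] with n h1 using
      antitone_dSep GenSymm.ostShuffle_nonneg (GenSymm.sum_ostShuffle h1)
  · refine tendsto_of_tendsto_of_tendsto_of_le_of_le' hTV tendsto_const_nhds ?_ ?_
    · filter_upwards [hTVSep, hlow] with n h1 h2 using h2.trans (h1 _)
    · filter_upwards [hSep1] with n h using h _
  · refine tendsto_of_tendsto_of_tendsto_of_le_of_le' tendsto_const_nhds hSep ?_ hupp
    filter_upwards [hSep0] with n h using h _
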